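/- \textbf{The system LF.} \emph{Types}: $e$, $t$, and $\langle\sigma\tau\rangle$ for types $\sigma,\tau$ (brackets associate to the right). \emph{Terms} (identified up to renaming of bound variables): infinitely many variables of each type; for each type $\sigma$ a constant $\subseteq_\sigma$ of type $\langle\sigma t\rangle\langle\sigma t\rangle t$ (written infix); applications $(fa):\tau$ for $f:\sigma\tau$, $a:\sigma$; abstractions $(\lambda x.A):\sigma\tau$ for a variable $x:\sigma$ and $A:\tau$. \emph{Formulae} are terms of type $t$; \emph{sentences} are formulae without free variables. $\beta$-equivalence $\sim_\beta$ is the least congruence with $(\lambda x.A)B\sim_\beta[B/x]A$. \emph{Definitions} ($p,q,r$ have type $t$): $\top:=(\lambda p.p)\subseteq(\lambda p.p)$; $\forall_\sigma:=\lambda X.((\lambda y.\top)\subseteq X)$; $\forall x.P:=\forall_\sigma\lambda x.P$; $\bot:=(\lambda p.\top)\subseteq(\lambda p.p)$; $\neg:=\lambda p.((\lambda r.p)\subseteq(\lambda r.\bot))$; $\exists_\sigma:=\lambda X.\neg\forall y.\neg Xy$; $\exists x.P:=\exists_\sigma\lambda x.P$; ${\to}:=\lambda pq.((\lambda r.p)\subseteq(\lambda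 r.q))$; ${\vee}:=\lambda pq.(\neg p\to q)$; ${\wedge}:=\lambda pq.\neg(\neg p\vee\neg q)$; ${=_\sigma}:=\lambda xy.((\lambda Z.Zx)\subseteq(\lambda Z.Zy))$; ${\ne_\sigma}:=\lambda xy.\neg(x=y)$; $0_\sigma:=\lambda X^{\sigma t}.\neg\exists_\sigma X$; $1_\sigma:=\lambda X^{\sigma t}.\exists y.(Xy\wedge\forall z.(Xz\to y=z))$; ${\setminus}:=\lambda XYz.(Xz\wedge\neg Yz)$; $+_\sigma:=\lambda mnX.\exists Y.(Y\subseteq X\wedge mY\wedge n(X\setminus Y))$; $\mathbb N_\sigma:=\lambda n^{\langle\sigma t\rangle t}.\forall X.(X0\to(X\subseteq\lambda y.X(y+1))\to Xn)$. \emph{Rules} for sequents $\Gamma\vdash P$ ($\Gamma$ a finite list of formulae, $P$ a formula): (1) the structural rules: $\Gamma,P\vdash P$, contraction, weakening, exchange, cut; (2) from $\Gamma\vdash P$ infer $\Gamma\vdash Q$ if $P\sim_\beta Q$; (3) from $\Gamma\vdash F\subseteq_\sigma G$ and $\Gamma\vdash Fa$ infer $\Gamma\vdash Ga$; (4) from $\Gamma,Fx\vdash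 Gx$ infer $\Gamma\vdash F\subseteq_\sigma G$, for a variable $x$ of type $\sigma$ not free in $F$, $G$, $\Gamma$; (5) from $\Gamma,\neg P\vdash P$ infer $\Gamma\vdash P$; (6) from $P\vdash Q$ and $Q\vdash P$ infer $\vdash P=Q$; (7) from $\Gamma\vdash fx=_\tau gx$ infer $\Gamma\vdash f=_{\sigma\tau}g$, for a variable $x$ of type $\sigma$ not free in $f$, $g$, $\Gamma$; (8) from $\Gamma\vdash\forall x^\sigma.\exists y^\tau.Rxy$ infer $\Gamma\vdash\exists f^{\sigma\tau}.\forall x.Rx(fx)$; (9) from $\Gamma\vdash\mathbb N_\sigma n$ infer $\Gamma\vdash\bot\neq\exists_{\sigma t}\,n$, for $\sigma\in\{e,t\}$. A \emph{theorem} of LF is a sentence $P$ such that $\vdash P$ (no assumptions) is derivable. \textbf{Theorem.} (i) The following is a theorem of LF: the propositions (the things of type $t$) form a complete atomic Boolean algebra under $\wedge,\vee,\neg$. That is, LF proves the conjunction of: the Boolean algebra laws, as universally quantified identities $=_t$ between propositions (commutativity, associativity, absorption, distributivity, $p\wedge\top=p$, $p\vee\bot=p$, $p\wedge\neg p=\bot$,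 $p\vee\neg p=\top$) together with $\bot\neq\top$; completeness, i.e. every property $X^{tt}$ of propositions has a least upper bound and a greatest lower bound for the order $p\le q:=((p\wedge q)=p)$; and atomicity, i.e. $$\forall p.\bigl(p\ne\bot\to\exists a.(\mathrm{Atom}\,a\wedge a\le p)\bigr),\qquad \mathrm{Atom}:=\lambda a.\bigl(a\neq\bot\wedge\forall q.(q\le a\to(q=\bot\vee q=a))\bigr).$$ (ii) LF proves that there are at least $2^{\aleph_0}$ propositions: for every type $\sigma$, it is a theorem of LF that some function from properties of numerals to propositions is injective on the classes of natural numbers, $$\exists f^{\langle\nu t\rangle t}.\forall X^{\nu t}.\forall Y^{\nu t}.\bigl((\mathrm{Class}\,X\wedge X\subseteq\mathbb N_\sigma)\wedge(\mathrm{Class}\,Y\wedge Y\subseteq\mathbb N_\sigma)\wedge fX=fY\;\to\;X=Y\bigr),$$ where $\nu=\langle\sigma t\rangle t$ and $\mathrm{Class}:=\lambda X^{\nu t}.\forall y.(Xy=\top\vee Xy=\bot)$. -/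

import Mathlib

/-!
The higher-order logic LF: simple types over `e` and `t`, terms (taken up to renaming of bound
variables), beta-equivalence, the natural deduction rules, and the sentences of the object language
saying that the propositions form a complete atomic Boolean algebra and that there are at least
continuum many of them.
-/

namespace LF

/-- Simple types: individuals `e`, propositions `t`, and functional types. -/
inductive Ty : Type
  | e : Ty
  | t : Ty
  | fn : Ty → Ty → Ty

open Ty

infixr:67 " ⇒ " => Ty.fn

/-- Typed de Bruijn indices, for the variables bound by enclosing abstractions. -/
inductive Idx : List Ty → Ty → Type
  | zero {Δ : List Ty} {σ : Ty} : Idx (σ :: Δ) σ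
  | succ {Δ : List Ty} {σ ρ : Ty} : Idx Δ σ → Idx (ρ :: Δ) σ

/-- `Tm Δ σ`: parts of type `σ` of terms, lying in the scope of abstractions that bind variables of
the types `Δ` (innermost first). `fvar σ n` is the `n`-th variable of type `σ`, occurring free;
each type has infinitely many variables. `incl σ` is the constant `⊆_σ`, the only kind of
constant. -/
inductive Tm : List Ty → Ty → Type
  | bvar {Δ : List Ty} {σ : Ty} : Idx Δ σ → Tm Δ σ
  | fvar {Δ : List Ty} (σ : Ty) (n : ℕ) : Tm Δ σ
  | incl {Δ : List Ty} (σ : Ty) : Tm Δ ((σ ⇒ t) ⇒ (σ ⇒ t) ⇒ t)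
  | app {Δ : List Ty} {σ τ : Ty} : Tm Δ (σ ⇒ τ) → Tm Δ σ → Tm Δ τ
  | lam {Δ : List Ty} {σ τ : Ty} : Tm (σ :: Δ) τ → Tm Δ (σ ⇒ τ)

/-- Terms of type `σ` (up to renaming of bound variables): no dangling bound variables. -/
abbrev Term (σ : Ty) : Type := Tm [] σ

/-- Formulae are terms of type `t`; they may contain free variables. -/
abbrev Formula : Type := Term t

namespace Tm

/-- The variable `fvar ρ n` occurs (free) in the term. -/
def Occurs (ρ : Ty) (n : ℕ) : {Δ : List Ty} → {σ : Ty} → Tm Δ σ → Prop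
  | _, _, bvar _ => False
  | _, _, fvar σ m => σ = ρ ∧ m = n
  | _, _, incl _ => False
  | _, _, app f a => Occurs ρ n f ∨ Occurs ρ n a
  | _, _, lam a => Occurs ρ n a

/-- Terms without free variables ("expressions"). -/
def Closed {Δ : List Ty} {σ : Ty} (A : Tm Δ σ) : Prop :=
  ∀ (ρ : Ty) (n : ℕ), ¬ Occurs ρ n A

/-! ### Capture-avoiding substitution for bound variables -/

/-- Lift a renaming of indices under one abstraction. -/
def liftRen {Δ Δ' : List Ty} {ρ : Ty} (r : ∀ σ : Ty, Idx Δ σ → Idx Δ' σ) :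
    ∀ σ : Ty, Idx (ρ :: Δ) σ → Idx (ρ :: Δ') σ
  | _, Idx.zero => Idx.zero
  | _, Idx.succ i => Idx.succ (r _ i)

/-- Renaming of indices. -/
def rename : {Δ Δ' : List Ty} → {σ : Ty} → (∀ ρ : Ty, Idx Δ ρ → Idx Δ' ρ) → Tm Δ σ → Tm Δ' σ
  | _, _, _, r, bvar i => bvar (r _ i)
  | _, _, _, _, fvar σ n => fvar σ n
  | _, _, _, _, incl σ => incl σ
  | _, _, _, r, app f a => app (rename r f) (rename r a)
  | _, _, _, r, lam a => lam (rename (liftRen r) a)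

/-- Regard a term as lying in the scope of one more abstraction, whose variable it does not
contain. -/
def wk {Δ : List Ty} {σ ρ : Ty} (A : Tm Δ σ) : Tm (ρ :: Δ) σ :=
  rename (fun _ i => Idx.succ i) A

/-- Lift a substitution under one abstraction. -/
def liftSub {Δ Δ' : List Ty} {ρ : Ty} (s : ∀ σ : Ty, Idx Δ σ → Tm Δ' σ) :
    ∀ σ : Ty, Idx (ρ :: Δ) σ → Tm (ρ :: Δ') σ
  | _, Idx.zero => bvar Idx.zero
  | _, Idx.succ i => wk (s _ i)

/-- Simultaneous substitution for indices. -/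
def subst : {Δ Δ' : List Ty} → {σ : Ty} → (∀ ρ : Ty, Idx Δ ρ → Tm Δ' ρ) → Tm Δ σ → Tm Δ' σ
  | _, _, _, s, bvar i => s _ i
  | _, _, _, _, fvar σ n => fvar σ n
  | _, _, _, _, incl σ => incl σ
  | _, _, _, s, app f a => app (subst s f) (subst s a)
  | _, _, _, s, lam a => lam (subst (liftSub s) a)

/-- The substitution sending the innermost bound variable to `B` and fixing all others. -/
def instSub {Δ : List Ty} {ρ : Ty} (B : Tm Δ ρ) : ∀ σ : Ty, Idx (ρ :: Δ) σ → Tm Δ σ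
  | _, Idx.zero => B
  | _, Idx.succ i => bvar i

/-- `[B/x]A`, where `x` is the innermost bound variable. -/
def inst {Δ : List Ty} {ρ σ : Ty} (A : Tm (ρ :: Δ) σ) (B : Tm Δ ρ) : Tm Δ σ :=
  subst (instSub B) A

end Tm

open Tm

/-- Beta-equivalence: the least congruence containing `(λx. A) B ∼ [B/x]A`. -/
inductive BetaEq : {Δ : List Ty} → {σ : Ty} → Tm Δ σ → Tm Δ σ → Prop
  | beta {Δ : List Ty} {σ τ : Ty} (A : Tm (σ :: Δ) τ) (B : Tm Δ σ) :
      BetaEq (app (lam A) B) (inst A B)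
  | refl {Δ : List Ty} {σ : Ty} (A : Tm Δ σ) : BetaEq A A
  | symm {Δ : List Ty} {σ : Ty} {A B : Tm Δ σ} : BetaEq A B → BetaEq B A
  | trans {Δ : List Ty} {σ : Ty} {A B C : Tm Δ σ} : BetaEq A B → BetaEq B C → BetaEq A C
  | app {Δ : List Ty} {σ τ : Ty} {f g : Tm Δ (σ ⇒ τ)} {a b : Tm Δ σ} :
      BetaEq f g → BetaEq a b → BetaEq (Tm.app f a) (Tm.app g b)
  | lam {Δ : List Ty} {σ τ : Ty} {A B : Tm (σ :: Δ) τ} :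
      BetaEq A B → BetaEq (Tm.lam A) (Tm.lam B)

/-! ### Defined logical vocabulary

The names ending in `C` are the defined terms themselves; the others are their applications. -/

section Vocabulary

variable {Δ : List Ty} {σ τ ρ κ μ : Ty}

/-- The variable bound by the innermost abstraction. -/
def v0 : Tm (σ :: Δ) σ := bvar Idx.zero
/-- The variable bound by the next abstraction outwards; similarly for `v2`, `v3`. -/
def v1 : Tm (τ :: σ :: Δ) σ := bvar (Idx.succ Idx.zero)
def v2 : Tm (ρ :: τ :: σ :: Δ) σ := bvar (Idx.succ (Idx.succ Idx.zero))
def v3 : Tm (κ :: ρ :: τ :: σ :: Δ) σ := bvar (Idx.succ (Idx.succ (Idx.succ Idx.zero)))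

/-- `F ⊆_σ G` -/
def sub (F G : Tm Δ (σ ⇒ t)) : Tm Δ t := app (app (incl σ) F) G

/-- `⊤ := (λp. p) ⊆ (λp. p)` -/
def top : Tm Δ t := sub (σ := t) (lam v0) (lam v0)

/-- `∀_σ := λX. ((λy. ⊤) ⊆ X)` -/
def allC : Tm Δ ((σ ⇒ t) ⇒ t) := lam (sub (lam top) v0)
/-- `∀x. P := ∀_σ λx. P` -/
def all (P : Tm (σ :: Δ) t) : Tm Δ t := app allC (lam P)

/-- `⊥ := (λp. ⊤) ⊆ (λp. p)` -/
def bot : Tm Δ t := sub (σ := t) (lam top) (lam v0)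

/-- `¬ := λp. ((λr. p) ⊆ (λr. ⊥))`, with `r` of type `t` -/
def negC : Tm Δ (t ⇒ t) := lam (sub (σ := t) (lam v1) (lam bot))
def neg (P : Tm Δ t) : Tm Δ t := app negC P

/-- `∃_σ := λX. ¬∀y. ¬Xy` -/
def exC : Tm Δ ((σ ⇒ t) ⇒ t) := lam (neg (all (neg (app v1 v0))))
/-- `∃x. P := ∃_σ λx. P` -/
def ex (P : Tm (σ :: Δ) t) : Tm Δ t := app exC (lam P)

/-- `→ := λpq. ((λr. p) ⊆ (λr. q))`, with `r` of type `t` -/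
def impC : Tm Δ (t ⇒ t ⇒ t) := lam (lam (sub (σ := t) (lam v2) (lam v1)))
def imp (P Q : Tm Δ t) : Tm Δ t := app (app impC P) Q

/-- `∨ := λpq. (¬p → q)` -/
def orC : Tm Δ (t ⇒ t ⇒ t) := lam (lam (imp (neg v1) v0))
def or (P Q : Tm Δ t) : Tm Δ t := app (app orC P) Q

/-- `∧ := λpq. ¬(¬p ∨ ¬q)` -/
def andC : Tm Δ (t ⇒ t ⇒ t) := lam (lam (neg (or (neg v1) (neg v0))))
def and (P Q : Tm Δ t) : Tm Δ t := app (app andC P) Q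

/-- `=_σ := λxy. ((λZ. Zx) ⊆ (λZ. Zy))` -/
def eqC : Tm Δ (σ ⇒ σ ⇒ t) :=
  lam (lam (sub (σ := σ ⇒ t) (lam (app v0 v2)) (lam (app v0 v1))))
def eq (a b : Tm Δ σ) : Tm Δ t := app (app eqC a) b

/-- `≠_σ := λxy. ¬(x = y)` -/
def neC : Tm Δ (σ ⇒ σ ⇒ t) := lam (lam (neg (eq v1 v0)))
def ne (a b : Tm Δ σ) : Tm Δ t := app (app neC a) b

/-- The type of numerals that count things of type `σ`. -/
abbrev numTy (σ : Ty) : Ty := (σ ⇒ t) ⇒ t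

/-- `0_σ := λX. ¬∃X` -/
def zeroC : Tm Δ (numTy σ) := lam (neg (app exC v0))

/-- `1_σ := λX. ∃y. (Xy ∧ ∀z. (Xz → y = z))` -/
def oneC : Tm Δ (numTy σ) :=
  lam (ex (and (app v1 v0) (all (imp (app v2 v0) (eq v1 v0)))))

/-- `∖ := λXYz. (Xz ∧ ¬Yz)`, for properties of things of type `σ` -/
def sdiffC : Tm Δ ((σ ⇒ t) ⇒ (σ ⇒ t) ⇒ σ ⇒ t) :=
  lam (lam (lam (and (app v2 v0) (neg (app v1 v0)))))

/-- `+_σ := λmnX. ∃Y. (Y ⊆ X ∧ mY ∧ n(X ∖ Y))` -/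
def addC : Tm Δ (numTy σ ⇒ numTy σ ⇒ numTy σ) :=
  lam (lam (lam (ex (and (sub v0 v1)
    (and (app v3 v0) (app v2 (app (app sdiffC v1) v0)))))))
def add (m n : Tm Δ (numTy σ)) : Tm Δ (numTy σ) := app (app addC m) n

/-- `ℕ_σ := λn. ∀X. (X0 → (X ⊆ λy. X(y + 1)) → Xn)` -/
def natC : Tm Δ (numTy σ ⇒ t) :=
  lam (all (imp (app v0 zeroC) (imp (sub v0 (lam (app v1 (add v0 oneC)))) (app v0 v1))))

end Vocabulary

/-! ### The deductive system -/

/-- `Provable Γ P`: the sequent `Γ ⊢ P` is derivable. A list of assumptions is written with its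
rightmost element first, so `Γ, P` is `P :: Γ` and `Γ, Δ` is `Δ ++ Γ`. -/
inductive Provable : List Formula → Formula → Prop
  /-- structural rules -/
  | ax (Γ : List Formula) (P : Formula) : Provable (P :: Γ) P
  | contract {Γ : List Formula} {P Q : Formula} :
      Provable (P :: P :: Γ) Q → Provable (P :: Γ) Q
  | weaken {Γ : List Formula} {P Q : Formula} : Provable Γ Q → Provable (P :: Γ) Q
  | exchange {Γ Δ : List Formula} {P Q R : Formula} :
      Provable (Δ ++ Q :: P :: Γ) R → Provable (Δ ++ P :: Q :: Γ) R
  | cut {Γ Δ : List Formula} {P Q : Formula} :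
      Provable Γ P → Provable (P :: Δ) Q → Provable (Δ ++ Γ) Q
  /-- beta-equivalence -/
  | beta {Γ : List Formula} {P Q : Formula} : Provable Γ P → BetaEq P Q → Provable Γ Q
  /-- universal instantiation -/
  | univInst {Γ : List Formula} {σ : Ty} {F G : Term (σ ⇒ t)} {a : Term σ} :
      Provable Γ (sub F G) → Provable Γ (app F a) → Provable Γ (app G a)
  /-- universal generalization; `x` is the variable `fvar σ n` -/
  | univGen {Γ : List Formula} {σ : Ty} {F G : Term (σ ⇒ t)} (n : ℕ) :
      ¬ Occurs σ n F → ¬ Occurs σ n G → (∀ P ∈ Γ, ¬ Occurs σ n P) →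
      Provable (app F (fvar σ n) :: Γ) (app G (fvar σ n)) → Provable Γ (sub F G)
  /-- negation elimination -/
  | negElim {Γ : List Formula} {P : Formula} : Provable (neg P :: Γ) P → Provable Γ P
  /-- intensionality -/
  | intens {P Q : Formula} : Provable [P] Q → Provable [Q] P → Provable [] (eq P Q)
  /-- function extensionality; `x` is the variable `fvar σ n` -/
  | funExt {Γ : List Formula} {σ τ : Ty} {f g : Term (σ ⇒ τ)} (n : ℕ) :
      ¬ Occurs σ n f → ¬ Occurs σ n g → (∀ P ∈ Γ, ¬ Occurs σ n P) →
      Provable Γ (eq (app f (fvar σ n)) (app g (fvar σ n))) → Provable Γ (eq f g)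
  /-- choice: from `∀x. ∃y. Rxy` infer `∃f. ∀x. Rx(fx)` -/
  | choice {Γ : List Formula} {σ τ : Ty} {R : Term (σ ⇒ τ ⇒ t)} :
      Provable Γ (all (σ := σ) (ex (σ := τ) (app (app (wk (wk R)) v1) v0))) →
      Provable Γ (ex (σ := σ ⇒ τ) (all (σ := σ) (app (app (wk (wk R)) v0) (app v1 v0))))
  /-- potential infinity: from `ℕ_σ n` infer `⊥ ≠ ∃n`, for `σ` a base type -/
  | potInf {Γ : List Formula} {σ : Ty} {n : Term (numTy σ)} :
      (σ = e ∨ σ = t) → Provable Γ (app natC n) → Provable Γ (ne bot (app exC n))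

/-- A theorem of LF: a sentence (closed formula) provable from no assumptions. -/
def IsTheorem (P : Formula) : Prop := P.Closed ∧ Provable [] P

/-! ### The propositions as a complete atomic Boolean algebra -/

section Sentences

variable {Δ : List Ty} {σ : Ty}

/-- The laws of Boolean algebra for `∧`, `∨`, `¬`, `⊥`, `⊤`, as identities between propositions:
commutativity, associativity, absorption, distributivity, bounds, complements, and `⊥ ≠ ⊤`. -/
def booleanAlgebra : Formula :=
  and (all (all (eq (and v1 v0) (and v0 v1)))) <|
  and (all (all (eq (or v1 v0) (or v0 v1)))) <|
  and (all (all (all (eq (and (and v2 v1) v0) (and v2 (and v1 v0)))))) <|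
  and (all (all (all (eq (or (or v2 v1) v0) (or v2 (or v1 v0)))))) <|
  and (all (all (eq (and v1 (or v1 v0)) v1))) <|
  and (all (all (eq (or v1 (and v1 v0)) v1))) <|
  and (all (all (all (eq (and v2 (or v1 v0)) (or (and v2 v1) (and v2 v0)))))) <|
  and (all (all (all (eq (or v2 (and v1 v0)) (and (or v2 v1) (or v2 v0)))))) <|
  and (all (eq (and v0 top) v0)) <|
  and (all (eq (or v0 bot) v0)) <|
  and (all (eq (and v0 (neg v0)) bot)) <|
  and (all (eq (or v0 (neg v0)) top)) <|
  ne bot top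

/-- The Boolean order: `λpq. (p ∧ q) = p` -/
def leC : Tm Δ (t ⇒ t ⇒ t) := lam (lam (eq (and v1 v0) v1))
def le (P Q : Tm Δ t) : Tm Δ t := app (app leC P) Q

/-- `λXu. ∀p. (Xp → p ≤ u)`: `u` is an upper bound of `X`. -/
def upperC : Tm Δ ((t ⇒ t) ⇒ t ⇒ t) := lam (lam (all (imp (app v2 v0) (le v0 v1))))

/-- `λXu. ∀p. (Xp → u ≤ p)`: `u` is a lower bound of `X`. -/
def lowerC : Tm Δ ((t ⇒ t) ⇒ t ⇒ t) := lam (lam (all (imp (app v2 v0) (le v1 v0))))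

/-- Every property of propositions has a least upper bound and a greatest lower bound. -/
def complete : Formula :=
  all (σ := t ⇒ t) (and
    (ex (and (app (app upperC v1) v0) (all (imp (app (app upperC v2) v0) (le v1 v0)))))
    (ex (and (app (app lowerC v1) v0) (all (imp (app (app lowerC v2) v0) (le v0 v1))))))

/-- `λa. (a ≠ ⊥ ∧ ∀q. (q ≤ a → (q = ⊥ ∨ q = a)))` -/
def atomC : Tm Δ (t ⇒ t) :=
  lam (and (ne v0 bot) (all (imp (le v0 v1) (or (eq v0 bot) (eq v0 v1)))))

/-- Every proposition other than `⊥` has an atom below it. -/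
def atomic : Formula :=
  all (imp (ne v0 bot) (ex (and (app atomC v0) (le v0 v1))))

/-- The propositions form a complete atomic Boolean algebra under `∧`, `∨`, `¬`. -/
def completeAtomicBooleanAlgebra : Formula := and booleanAlgebra (and complete atomic)

/-! ### At least continuum many propositions -/

/-- `Class_σ := λX. ∀y. (Xy = ⊤ ∨ Xy = ⊥)`: classes are the `{⊤, ⊥}`-valued functions. -/
def classC : Tm Δ ((σ ⇒ t) ⇒ t) := lam (all (or (eq (app v1 v0) top) (eq (app v1 v0) bot)))

/-- `λX. (Class X ∧ X ⊆ ℕ_σ)`: `X` is a class of natural numbers. -/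
def natClassC : Tm Δ ((numTy σ ⇒ t) ⇒ t) := lam (and (app classC v0) (sub v0 natC))

/-- There are at least `2^ℵ₀` propositions: some function from properties of numerals to
propositions is injective on the classes of natural numbers (of `ℕ_σ`). -/
def atLeastContinuum (σ : Ty) : Formula :=
  ex (σ := (numTy σ ⇒ t) ⇒ t) (all (σ := numTy σ ⇒ t) (all (σ := numTy σ ⇒ t)
    (imp (and (app natClassC v1) (and (app natClassC v0) (eq (app v2 v1) (app v2 v0))))
      (eq v1 v0))))

end Sentences

end LF

/-!
The derivations are not written out rule by rule. Instead, provability is characterised by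
completeness with respect to term models, and the two sentences are verified in all such models by
ordinary mathematics.

*Models.* A Henkin theory `M` is a deductively closed, consistent set of formulae in which every
inclusion that fails has a counterexample; an unprovable formula is missed by some Henkin theory
(`exists_henkin`). Terms modulo identity in `M` form domains `M.D σ` with application, truth `D.T` and
denotation `den`; functions are extensional (`D.ext`), the choice rule gives actual choice
functions (`exists_choice`), and the intensionality rule says that formulae with the same
truth value in all models, under all assignments, denote the same proposition in all models
(`den_congr`). Thus each fact established for all models is also available as an identity `= ⊤`, a
form of necessitation.

*The algebra of propositions.* By intensionality the propositions of a model form a Boolean algebra,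
and by function extensionality the quantifiers are infinite meets and joins (`le_all`, `ex_le`): the
Barcan formula holds. By choice every property is coextensive with a class, a function with values
`⊤` and `⊥` (`exists_class`). Applied to the property of being identical with `a` this shows that
identity and distinctness are necessary (`D.Rigid.eqv`). Applied to an arbitrary property of
propositions it gives greatest lower bounds. Applied to truth it gives the meet of all true
propositions, which is a true atom; as it is necessary that there is a true atom, and being an atom
is rigid, every possible proposition lies above an atom.

*Continuum many propositions.* Potential infinity at type `t` says that for no natural number `n` it is
impossible that there are `n` propositions. If `⊤` were a join of finitely many atoms, the
propositions would be bounded in number: the propositions up to `p ∨ a`, with `a` an atom, fall into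
two intervals of length `p` (`interval_sup_atom`), so that adjoining one interval more preserves
boundedness (`T_bounded_interval`). Hence one can start from `⊥` and keep adding a chosen new atom.
The iterates of this step are related to the numbers of the given type by the least relation
closed under simultaneous succession (`iterC`). Two iterates are comparable and, if equal, have equal
indices (`iter_trichotomy`); this needs no information on how many numbers of that type there are.
Choosing an iterate for every number and taking increments, one gets nonzero, pairwise disjoint
propositions indexed by the numbers, and a class of numbers is recovered from the join of the
propositions that belong to its members.
-/

namespace LF

open Ty Tm

/-! ### Substitution -/

namespace Tm

theorem liftRen_comp {Δ Δ' Δ'' : List Ty} {ρ : Ty} (r : ∀ σ : Ty, Idx Δ σ → Idx Δ' σ)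
    (r' : ∀ σ : Ty, Idx Δ' σ → Idx Δ'' σ) :
    (fun σ i => liftRen (ρ := ρ) r' σ (liftRen r σ i)) = liftRen (fun σ i => r' σ (r σ i)) := by
  funext σ i; cases i <;> rfl

theorem rename_rename {Δ Δ' Δ'' : List Ty} {σ : Ty} (r : ∀ σ : Ty, Idx Δ σ → Idx Δ' σ)
    (r' : ∀ σ : Ty, Idx Δ' σ → Idx Δ'' σ) (A : Tm Δ σ) :
    rename r' (rename r A) = rename (fun σ i => r' σ (r σ i)) A := by
  induction A generalizing Δ' Δ'' with
  | bvar i => rfl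
  | fvar σ n => rfl
  | incl σ => rfl
  | app f a ihf iha => simp only [rename, ihf, iha]
  | lam a ih => simp only [rename, ih, liftRen_comp]

theorem subst_rename {Δ Δ' Δ'' : List Ty} {σ : Ty} (r : ∀ σ : Ty, Idx Δ σ → Idx Δ' σ)
    (s : ∀ σ : Ty, Idx Δ' σ → Tm Δ'' σ) (A : Tm Δ σ) :
    subst s (rename r A) = subst (fun σ i => s σ (r σ i)) A := by
  induction A generalizing Δ' Δ'' with
  | bvar i => rfl
  | fvar σ n => rfl
  | incl σ => rfl
  | app f a ihf iha => simp only [rename, subst, ihf, iha]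
  | lam a ih =>
    simp only [rename, subst, ih]
    congr 2
    funext σ i; cases i <;> rfl

theorem rename_wk {Δ Δ' : List Ty} {σ ρ : Ty} (r : ∀ σ : Ty, Idx Δ σ → Idx Δ' σ) (A : Tm Δ σ) :
    rename (liftRen (ρ := ρ) r) (wk A) = wk (rename r A) := by
  simp only [wk, rename_rename]; rfl

theorem rename_subst {Δ Δ' Δ'' : List Ty} {σ : Ty} (s : ∀ σ : Ty, Idx Δ σ → Tm Δ' σ)
    (r : ∀ σ : Ty, Idx Δ' σ → Idx Δ'' σ) (A : Tm Δ σ) :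
    rename r (subst s A) = subst (fun σ i => rename r (s σ i)) A := by
  induction A generalizing Δ' Δ'' with
  | bvar i => rfl
  | fvar σ n => rfl
  | incl σ => rfl
  | app f a ihf iha => simp only [rename, subst, ihf, iha]
  | lam a ih =>
    simp only [rename, subst, ih]
    congr 2
    funext σ i; cases i
    · rfl
    · exact rename_wk _ _

theorem subst_wk {Δ Δ' : List Ty} {σ ρ : Ty} (s : ∀ σ : Ty, Idx Δ σ → Tm Δ' σ) (A : Tm Δ σ) :
    subst (liftSub (ρ := ρ) s) (wk A) = wk (subst s A) := by
  simp only [wk, subst_rename, rename_subst]; rfl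

theorem subst_subst {Δ Δ' Δ'' : List Ty} {σ : Ty} (s : ∀ σ : Ty, Idx Δ σ → Tm Δ' σ)
    (s' : ∀ σ : Ty, Idx Δ' σ → Tm Δ'' σ) (A : Tm Δ σ) :
    subst s' (subst s A) = subst (fun σ i => subst s' (s σ i)) A := by
  induction A generalizing Δ' Δ'' with
  | bvar i => rfl
  | fvar σ n => rfl
  | incl σ => rfl
  | app f a ihf iha => simp only [subst, ihf, iha]
  | lam a ih =>
    simp only [subst, ih]
    congr 2
    funext σ i; cases i
    · rfl
    · exact subst_wk _ _

theorem subst_bvar {Δ : List Ty} {σ : Ty} (A : Tm Δ σ) : subst (fun _ i => bvar i) A = A := by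
  induction A with
  | bvar i => rfl
  | fvar σ n => rfl
  | incl σ => rfl
  | app f a ihf iha => simp only [subst, ihf, iha]
  | lam a ih =>
    rw [subst]
    congr 1
    refine Eq.trans ?_ ih
    congr 1
    funext σ i; cases i <;> rfl

theorem subst_nil {σ : Ty} (s : ∀ σ : Ty, Idx [] σ → Tm [] σ) (A : Term σ) : subst s A = A := by
  refine Eq.trans ?_ (subst_bvar A)
  congr 1
  funext σ i; cases i

/-- Extend a substitution by a value for the innermost variable. -/
def consSub {Δ Δ' : List Ty} {ρ : Ty} (c : Tm Δ' ρ) (s : ∀ σ : Ty, Idx Δ σ → Tm Δ' σ) :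
    ∀ σ : Ty, Idx (ρ :: Δ) σ → Tm Δ' σ
  | _, Idx.zero => c
  | _, Idx.succ i => s _ i

theorem inst_wk {Δ : List Ty} {σ ρ : Ty} (A : Tm Δ σ) (c : Tm Δ ρ) : inst (wk A) c = A := by
  rw [inst, wk, subst_rename]
  exact subst_bvar A

theorem inst_subst_liftSub {Δ Δ' : List Ty} {σ ρ : Ty} (s : ∀ σ : Ty, Idx Δ σ → Tm Δ' σ)
    (A : Tm (ρ :: Δ) σ) (c : Tm Δ' ρ) :
    inst (subst (liftSub s) A) c = subst (consSub c s) A := by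
  rw [inst, subst_subst]
  congr 1
  funext σ i; cases i
  · rfl
  · exact inst_wk _ _

theorem occurs_rename {Δ Δ' : List Ty} {σ : Ty} (r : ∀ σ : Ty, Idx Δ σ → Idx Δ' σ)
    (ρ : Ty) (n : ℕ) (A : Tm Δ σ) : Occurs ρ n (rename r A) ↔ Occurs ρ n A := by
  induction A generalizing Δ' with
  | bvar i => rfl
  | fvar σ n => rfl
  | incl σ => rfl
  | app f a ihf iha => simp only [rename, Occurs, ihf, iha]
  | lam a ih => simp only [rename, Occurs, ih]

theorem occurs_wk {Δ : List Ty} {σ κ : Ty} (ρ : Ty) (n : ℕ) (A : Tm Δ σ) :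
    Occurs ρ n (wk (ρ := κ) A) ↔ Occurs ρ n A := occurs_rename _ _ _ _

theorem exists_fresh_bound {Δ : List Ty} {σ : Ty} (A : Tm Δ σ) :
    ∃ N : ℕ, ∀ n, N ≤ n → ∀ ρ, ¬ Occurs ρ n A := by
  induction A with
  | bvar i => exact ⟨0, fun _ _ _ h => h⟩
  | fvar σ m => exact ⟨m + 1, fun n hn ρ h => by have := h.2; omega⟩
  | incl σ => exact ⟨0, fun _ _ _ h => h⟩
  | app f a ihf iha =>
    obtain ⟨N, hN⟩ := ihf
    obtain ⟨N', hN'⟩ := iha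
    exact ⟨max N N', fun n hn ρ h => h.elim (hN n (le_of_max_le_left hn) ρ)
      (hN' n (le_of_max_le_right hn) ρ)⟩
  | lam a ih => exact ih

theorem exists_fresh_bound_list (Γ : List Formula) :
    ∃ N : ℕ, ∀ n, N ≤ n → ∀ ρ, ∀ P ∈ Γ, ¬ Occurs ρ n P := by
  induction Γ with
  | nil => exact ⟨0, by simp⟩
  | cons P Γ ih =>
    obtain ⟨N, hN⟩ := ih
    obtain ⟨N', hN'⟩ := exists_fresh_bound P
    refine ⟨max N N', fun n hn ρ Q hQ => ?_⟩
    rcases List.mem_cons.1 hQ with rfl | hQ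
    · exact hN' n (le_of_max_le_right hn) ρ
    · exact hN n (le_of_max_le_left hn) ρ Q hQ

/-- A variable that is fresh for two terms and a context. -/
theorem exists_fresh {σ τ : Ty} (A : Term σ) (B : Term τ) (Γ : List Formula) :
    ∃ n : ℕ, ∀ ρ, ¬ Occurs ρ n A ∧ ¬ Occurs ρ n B ∧ ∀ P ∈ Γ, ¬ Occurs ρ n P := by
  obtain ⟨a, ha⟩ := exists_fresh_bound A
  obtain ⟨b, hb⟩ := exists_fresh_bound B
  obtain ⟨g, hg⟩ := exists_fresh_bound_list Γ
  exact ⟨a + b + g, fun ρ => ⟨ha _ (by omega) ρ, hb _ (by omega) ρ, hg _ (by omega) ρ⟩⟩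

end Tm

/-! ### Countability of the language -/

theorem exists_code_ty : ∃ c : Ty → ℕ, Function.Injective c := by
  let c : Ty → ℕ := Ty.rec 0 1 (fun _ _ m n => Nat.pair m n + 2)
  refine ⟨c, fun σ τ h => ?_⟩
  induction σ generalizing τ with
  | e => cases τ <;> simp [c] at h ⊢
  | t => cases τ <;> simp [c] at h ⊢
  | fn a b iha ihb =>
    cases τ with
    | e => simp [c] at h
    | t => simp [c] at h
    | fn a' b' =>
      have h' : Nat.pair (c a) (c b) = Nat.pair (c a') (c b') := Nat.add_right_cancel h
      obtain ⟨h1, h2⟩ := Nat.pair_eq_pair.1 h'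
      rw [iha a' h1, ihb b' h2]

instance : Countable Ty := let ⟨_, h⟩ := exists_code_ty; h.countable

/-- The position of a de Bruijn index. -/
def Idx.pos {Δ : List Ty} {σ : Ty} : Idx Δ σ → ℕ
  | .zero => 0
  | .succ i => i.pos + 1

theorem Idx.pos_injective {Δ : List Ty} {σ : Ty} :
    Function.Injective (Idx.pos : Idx Δ σ → ℕ) := by
  intro i j h
  induction i with
  | zero => cases j with
    | zero => rfl
    | succ j => simp [Idx.pos] at h
  | succ i ih => cases j with
    | zero => simp [Idx.pos] at h
    | succ j => rw [ih (Nat.add_right_cancel h)]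

/-- A numerical code of a term, relative to a coding `c` of types. -/
def Tm.code (c : Ty → ℕ) : {Δ : List Ty} → {σ : Ty} → Tm Δ σ → ℕ
  | _, _, bvar i => Nat.pair 0 i.pos
  | _, _, fvar _ n => Nat.pair 1 n
  | _, _, incl _ => Nat.pair 2 0
  | _, _, @app _ σ _ f a => Nat.pair 3 (Nat.pair (c σ) (Nat.pair (code c f) (code c a)))
  | _, _, lam a => Nat.pair 4 (code c a)

theorem Tm.code_injective {c : Ty → ℕ} (hc : Function.Injective c) {Δ : List Ty} {σ : Ty} :
    Function.Injective (Tm.code c : Tm Δ σ → ℕ) := by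
  intro A B h
  induction A with
  | bvar i =>
    cases B <;> simp [Tm.code, Nat.pair_eq_pair] at h
    rw [Idx.pos_injective h]
  | fvar σ n =>
    cases B <;> simp [Tm.code, Nat.pair_eq_pair] at h
    rw [h]
  | incl σ =>
    cases B <;> simp [Tm.code, Nat.pair_eq_pair] at h
    rfl
  | app f a ihf iha =>
    cases B <;> simp [Tm.code, Nat.pair_eq_pair] at h
    obtain ⟨h1, h2, h3⟩ := h
    obtain rfl := hc h1
    rw [ihf h2, iha h3]
  | lam a ih =>
    cases B <;> simp [Tm.code, Nat.pair_eq_pair] at h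
    rw [ih h]

instance (Δ : List Ty) (σ : Ty) : Countable (Tm Δ σ) :=
  let ⟨_, h⟩ := exists_code_ty; (Tm.code_injective h).countable

/-! ### Derived rules -/

namespace Provable

theorem perm {Γ Γ' : List Formula} {P : Formula} (h : Γ.Perm Γ') :
    Provable Γ P → Provable Γ' P := by
  suffices H : ∀ Ξ : List Formula, Provable (Ξ ++ Γ) P → Provable (Ξ ++ Γ') P from H []
  induction h with
  | nil => exact fun _ => id
  | cons a _ ih => intro Ξ hp; simpa using ih (Ξ ++ [a]) (by simpa using hp)
  | swap a b l => exact fun Ξ hp => exchange hp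
  | trans _ _ ih ih' => exact fun Ξ hp => ih' Ξ (ih Ξ hp)

theorem contract_mem {Γ : List Formula} {P Q : Formula} (hQ : Q ∈ Γ) (h : Provable (Q :: Γ) P) :
    Provable Γ P := by
  obtain ⟨l, l', rfl⟩ := List.append_of_mem hQ
  have e : (l ++ Q :: l').Perm (Q :: (l ++ l')) := List.perm_middle
  exact (contract (h.perm (e.cons Q))).perm e.symm

theorem mono {Γ Γ' : List Formula} {P : Formula} (hs : Γ ⊆ Γ') (h : Provable Γ P) :
    Provable Γ' P := by
  have h1 : Provable (Γ ++ Γ') P := by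
    refine perm List.perm_append_comm ?_
    clear hs
    induction Γ' with
    | nil => exact h
    | cons a l ih => exact ih.weaken
  clear h
  induction Γ with
  | nil => exact h1
  | cons a l ih =>
    exact ih (fun x hx => hs (List.mem_cons_of_mem _ hx))
      (contract_mem (List.mem_append_right _ (hs List.mem_cons_self)) h1)

theorem of_mem {Γ : List Formula} {P : Formula} (h : P ∈ Γ) : Provable Γ P :=
  contract_mem h (ax Γ P)

theorem cut_same {Γ : List Formula} {P Q : Formula} (h : Provable Γ P)
    (h' : Provable (P :: Γ) Q) : Provable Γ Q :=
  (cut h h').mono (by simp)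

/-- Cut a whole list of assumptions. -/
theorem cut_list {Γ Δ : List Formula} {Q : Formula} (h : ∀ P ∈ Δ, Provable Γ P)
    (h' : Provable Δ Q) : Provable Γ Q := by
  suffices H : ∀ Δ : List Formula, (∀ P ∈ Δ, Provable Γ P) → Provable (Δ ++ Γ) Q → Provable Γ Q from
    H Δ h (h'.mono (by simp))
  intro Δ
  induction Δ with
  | nil => exact fun _ => id
  | cons P Δ ih =>
    intro hΔ hp
    refine ih (fun R hR => hΔ R (List.mem_cons_of_mem _ hR)) (cut_same (P := P) ?_ hp)
    exact (hΔ P List.mem_cons_self).mono (by simp)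

theorem top_intro (Γ : List Formula) : Provable Γ LF.top :=
  (univGen (Γ := []) (F := Tm.lam v0) (G := Tm.lam v0) 0 id id (by simp) (ax _ _)).mono (by simp)

theorem bot_elim {Γ : List Formula} {P : Formula} (h : Provable Γ LF.bot) : Provable Γ P :=
  (univInst (a := P) h ((top_intro Γ).beta (BetaEq.beta LF.top P).symm)).beta (BetaEq.beta v0 P)

theorem neg_betaEq (P : Formula) :
    BetaEq (neg P) (sub (σ := t) (Tm.lam (wk P)) (Tm.lam LF.bot)) :=
  BetaEq.beta (sub (σ := t) (Tm.lam v1) (Tm.lam LF.bot)) P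

theorem lam_wk_betaEq {σ τ : Ty} (A : Term τ) (a : Term σ) :
    BetaEq (Tm.app (Tm.lam (wk A)) a) A := by
  simpa only [inst_wk] using BetaEq.beta (wk A) a

theorem neg_intro {Γ : List Formula} {P : Formula} (h : Provable (P :: Γ) LF.bot) :
    Provable Γ (neg P) := by
  obtain ⟨n, hn⟩ := exists_fresh P P Γ
  refine beta (univGen n ?_ ?_ (hn t).2.2 ?_) (neg_betaEq P).symm
  · exact fun h => (hn t).1 ((occurs_wk _ _ _).1 h)
  · simp [LF.bot, LF.top, sub, v0, Occurs]
  · refine beta ?_ (BetaEq.beta LF.bot _).symm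
    refine cut_same ((ax _ _).beta (lam_wk_betaEq P _)) (h.mono ?_)
    simp

theorem neg_elim {Γ : List Formula} {P : Formula} (h : Provable Γ P) (h' : Provable Γ (neg P)) :
    Provable Γ LF.bot :=
  (univInst (a := LF.bot) (h'.beta (neg_betaEq P)) (h.beta (lam_wk_betaEq P _).symm)).beta
    (BetaEq.beta LF.bot _)

theorem by_contra {Γ : List Formula} {P : Formula} (h : Provable (neg P :: Γ) LF.bot) :
    Provable Γ P := negElim h.bot_elim

end Provable

/-! ### Henkin theories -/

/-- A Henkin theory: a deductively closed, consistent set of formulae in which every inclusion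
`F ⊆ G` that is not a member is refuted by an instance. -/
structure Henkin where
  /-- The formulae that hold. -/
  carrier : Set Formula
  /-- Provable consequences of members are members. -/
  closed : ∀ {Γ : List Formula} {P : Formula}, (∀ Q ∈ Γ, Q ∈ carrier) → Provable Γ P → P ∈ carrier
  /-- The theory is not trivial. -/
  consistent : LF.bot ∉ carrier
  /-- Inclusions that are not members have counterexamples. -/
  witness : ∀ {σ : Ty} {F G : Term (σ ⇒ t)}, sub F G ∉ carrier →
    ∃ a, app F a ∈ carrier ∧ app G a ∉ carrier

/-- One step of the construction of a Henkin theory: if a formula cannot be assumed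
consistently and is an inclusion, add a fresh counterexample to it. -/
theorem exists_henkin_step (Γ : List Formula) (hΓ : ¬ Provable Γ LF.bot) (Q : Formula) :
    ∃ Γ' : List Formula, ¬ Provable Γ' LF.bot ∧ Γ ⊆ Γ' ∧
      (Q ∈ Γ' ∨ ∀ (σ : Ty) (F G : Term (σ ⇒ t)), Q = sub F G →
        ∃ a, app F a ∈ Γ' ∧ neg (app G a) ∈ Γ') := by
  by_cases h1 : Provable (Q :: Γ) LF.bot
  swap
  · exact ⟨Q :: Γ, h1, by simp, Or.inl (by simp)⟩
  have h2 : ¬ Provable (neg Q :: Γ) LF.bot := fun h => hΓ ((h1.neg_intro).cut_same h)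
  by_cases hQ : ∃ (σ : Ty) (F G : Term (σ ⇒ t)), Q = sub F G
  swap
  · exact ⟨Γ, hΓ, fun _ => id, Or.inr fun σ F G h => (hQ ⟨σ, F, G, h⟩).elim⟩
  obtain ⟨σ, F, G, rfl⟩ := hQ
  obtain ⟨n, hn⟩ := exists_fresh F G (neg (sub F G) :: Γ)
  refine ⟨neg (app G (fvar σ n)) :: app F (fvar σ n) :: neg (sub F G) :: Γ, fun h => h2 ?_, ?_,
    Or.inr ?_⟩
  · have := Provable.univGen n (hn σ).1 (hn σ).2.1 (hn σ).2.2 h.by_contra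
    exact this.neg_elim (Provable.ax _ _)
  · intro x hx; simp [hx]
  · rintro σ' F' G' h
    simp only [sub] at h
    cases h
    exact ⟨fvar σ n, by simp, by simp⟩

/-- Lindenbaum's lemma with witnesses. -/
theorem exists_henkin {Γ : List Formula} {P : Formula} (h : ¬ Provable Γ P) :
    ∃ M : Henkin, (∀ Q ∈ Γ, Q ∈ M.carrier) ∧ P ∉ M.carrier := by
  have : Nonempty Formula := ⟨LF.bot⟩
  obtain ⟨enum, henum⟩ := exists_surjective_nat Formula
  choose! next hnext using exists_henkin_step
  -- `G k` is the list of assumptions after the first `k` formulae have been treated.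
  let G : ℕ → List Formula := fun k => Nat.rec (neg P :: Γ) (fun k Γ' => next Γ' (enum k)) k
  have hcons : ∀ k, ¬ Provable (G k) LF.bot := by
    intro k
    induction k with
    | zero => exact fun h' => h h'.by_contra
    | succ k ih => exact (hnext _ ih (enum k)).1
  have hstep : ∀ k, G k ⊆ G (k + 1) := fun k => (hnext _ (hcons k) (enum k)).2.1
  have hmono : ∀ {k l}, k ≤ l → G k ⊆ G l := by
    intro k l hkl
    induction hkl with
    | refl => exact fun _ => id
    | step _ ih => exact fun _ hx => hstep _ (ih hx)
  have hfin : ∀ Δ : List Formula, (∀ Q ∈ Δ, ∃ k, Provable (G k) Q) →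
      ∃ k, ∀ Q ∈ Δ, Provable (G k) Q := by
    intro Δ
    induction Δ with
    | nil => exact fun _ => ⟨0, by simp⟩
    | cons Q Δ ih =>
      intro hΔ
      obtain ⟨k, hk⟩ := ih fun R hR => hΔ R (List.mem_cons_of_mem _ hR)
      obtain ⟨l, hl⟩ := hΔ Q List.mem_cons_self
      refine ⟨max k l, fun R hR => ?_⟩
      rcases List.mem_cons.1 hR with rfl | hR
      · exact hl.mono (hmono (le_max_right _ _))
      · exact (hk R hR).mono (hmono (le_max_left _ _))
  have hnot : ∀ {Q k}, neg Q ∈ G k → ¬ ∃ l, Provable (G l) Q := by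
    rintro Q k hk ⟨l, hl⟩
    refine hcons (max k l) ((hl.mono (hmono (le_max_right _ _))).neg_elim ?_)
    exact Provable.of_mem (hmono (le_max_left _ _) hk)
  refine ⟨⟨{Q | ∃ k, Provable (G k) Q}, ?_, ?_, ?_⟩, ?_, ?_⟩
  · intro Δ Q hΔ hQ
    obtain ⟨k, hk⟩ := hfin Δ hΔ
    exact ⟨k, Provable.cut_list hk hQ⟩
  · rintro ⟨k, hk⟩
    exact hcons k hk
  · intro σ F F' hF
    obtain ⟨k, hk⟩ := henum (sub F F')
    rcases (hnext _ (hcons k) (enum k)).2.2 with h' | h'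
    · exact (hF ⟨k + 1, Provable.of_mem (hk ▸ h')⟩).elim
    · obtain ⟨a, ha, ha'⟩ := h' σ F F' hk
      exact ⟨a, ⟨k + 1, Provable.of_mem ha⟩, hnot (k := k + 1) ha'⟩
  · exact fun Q hQ => ⟨0, Provable.of_mem (List.mem_cons_of_mem _ hQ)⟩
  · exact hnot (k := 0) List.mem_cons_self

namespace Henkin

variable {M : Henkin} {Δ Δ' : List Ty} {σ τ : Ty}

theorem mem_of_provable {P : Formula} (h : Provable [] P) : P ∈ M.carrier :=
  M.closed (by simp) h

theorem mem_of_provable₁ {P Q : Formula} (hP : P ∈ M.carrier) (h : Provable [P] Q) :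
    Q ∈ M.carrier := M.closed (by simpa using hP) h

theorem mem_beta {P Q : Formula} (h : BetaEq P Q) : P ∈ M.carrier ↔ Q ∈ M.carrier :=
  ⟨fun hP => mem_of_provable₁ hP ((Provable.ax _ _).beta h),
    fun hQ => mem_of_provable₁ hQ ((Provable.ax _ _).beta h.symm)⟩

theorem mem_app_lam (A : Tm [σ] t) (a : Term σ) :
    app (lam A) a ∈ M.carrier ↔ inst A a ∈ M.carrier := mem_beta (BetaEq.beta A a)

theorem mem_sub {F G : Term (σ ⇒ t)} :
    sub F G ∈ M.carrier ↔ ∀ a, app F a ∈ M.carrier → app G a ∈ M.carrier := by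
  constructor
  · intro h a ha
    refine M.closed (Γ := [sub F G, app F a]) (by simp [h, ha]) ?_
    exact Provable.univInst (Provable.ax _ _) (Provable.of_mem (by simp))
  · intro h
    by_contra hn
    obtain ⟨a, ha, ha'⟩ := M.witness hn
    exact ha' (h a ha)

theorem eq_betaEq (a b : Term σ) : BetaEq (eq a b)
    (sub (σ := σ ⇒ t) (lam (app v0 (wk a))) (lam (app v0 (wk b)))) := by
  refine (BetaEq.app (BetaEq.beta _ a) (BetaEq.refl b)).trans ?_
  refine (BetaEq.beta (sub (σ := σ ⇒ t) (lam (app v0 (wk (wk a)))) (lam (app v0 v1))) b).trans ?_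
  have : inst (sub (σ := σ ⇒ t) (lam (app v0 (wk (wk a)))) (lam (app v0 v1))) b
      = sub (σ := σ ⇒ t) (lam (app v0 (wk a))) (lam (app v0 (wk b))) := by
    have h : subst (liftSub (ρ := σ ⇒ t) (instSub b)) (wk (wk a)) = wk a := by
      rw [subst_wk]
      exact congrArg wk (inst_wk a b)
    simp only [inst, sub, subst, h]
    rfl
  rw [this]
  exact BetaEq.refl _

/-- Identity statements mean indiscernibility. -/
theorem mem_eq {a b : Term σ} :
    eq a b ∈ M.carrier ↔ ∀ Z : Term (σ ⇒ t), app Z a ∈ M.carrier → app Z b ∈ M.carrier := by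
  rw [mem_beta (eq_betaEq a b), mem_sub]
  refine forall_congr' fun Z => ?_
  have h : ∀ c : Term σ, app (lam (app v0 (wk c))) Z ∈ M.carrier ↔ app Z c ∈ M.carrier := by
    intro c
    have e : inst (app v0 (wk c)) Z = app Z c := by
      conv_rhs => rw [← inst_wk c Z]
      rfl
    rw [mem_app_lam, e]
  rw [h, h]

theorem mem_eq_of_betaEq {a b : Term σ} (h : BetaEq a b) : eq a b ∈ M.carrier :=
  mem_eq.2 fun Z => (mem_beta (BetaEq.app (BetaEq.refl Z) h)).1

theorem mem_eq_refl (a : Term σ) : eq a a ∈ M.carrier := mem_eq.2 fun _ => id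

/-- Leibniz's law for contexts with one hole. -/
theorem mem_inst_of_mem_eq {a b : Term σ} (h : eq a b ∈ M.carrier) (A : Tm [σ] t)
    (hA : inst A a ∈ M.carrier) : inst A b ∈ M.carrier :=
  (mem_app_lam A b).1 (mem_eq.1 h _ ((mem_app_lam A a).2 hA))

theorem mem_eq_symm {a b : Term σ} (h : eq a b ∈ M.carrier) : eq b a ∈ M.carrier := by
  have e : ∀ c, inst (eq v0 (wk a)) c = eq c a := fun c => by
    conv_rhs => rw [← inst_wk a c]
    rfl
  rw [← e]
  exact mem_inst_of_mem_eq h _ ((e a).symm ▸ mem_eq_refl a)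

theorem mem_eq_trans {a b c : Term σ} (h : eq a b ∈ M.carrier) (h' : eq b c ∈ M.carrier) :
    eq a c ∈ M.carrier :=
  mem_eq.2 fun Z hZ => mem_eq.1 h' Z (mem_eq.1 h Z hZ)

theorem mem_eq_app {f g : Term (σ ⇒ τ)} {a b : Term σ} (h : eq f g ∈ M.carrier)
    (h' : eq a b ∈ M.carrier) : eq (app f a) (app g b) ∈ M.carrier := by
  refine mem_eq.2 fun Z hZ => ?_
  have e1 : ∀ c, inst (app (wk Z) (app v0 (wk a))) c = app Z (app c a) := fun c => by
    conv_rhs => rw [← inst_wk Z c, ← inst_wk a c]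
    rfl
  have e2 : ∀ c, inst (app (wk Z) (app (wk g) v0)) c = app Z (app g c) := fun c => by
    conv_rhs => rw [← inst_wk Z c, ← inst_wk g c]
    rfl
  rw [← e2]
  refine mem_inst_of_mem_eq h' _ ?_
  rw [e2, ← e1]
  refine mem_inst_of_mem_eq h _ ?_
  rwa [e1]

theorem mem_iff_of_mem_eq {P Q : Formula} (h : eq P Q ∈ M.carrier) :
    P ∈ M.carrier ↔ Q ∈ M.carrier :=
  ⟨mem_inst_of_mem_eq h v0, mem_inst_of_mem_eq (mem_eq_symm h) v0⟩

/-- Functions that agree on all terms are equal. -/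
theorem mem_eq_ext {f g : Term (σ ⇒ τ)} (h : ∀ a, eq (app f a) (app g a) ∈ M.carrier) :
    eq f g ∈ M.carrier := by
  let E : Tm [σ] t := eq (app (wk f) v0) (app (wk g) v0)
  have e : ∀ c, inst E c = eq (app f c) (app g c) := fun c => by
    conv_rhs => rw [← inst_wk f c, ← inst_wk g c]
    rfl
  have h1 : sub (lam LF.top) (lam E) ∈ M.carrier :=
    mem_sub.2 fun a _ => (mem_app_lam E a).2 ((e a).symm ▸ h a)
  refine mem_of_provable₁ h1 ?_
  obtain ⟨n, hn⟩ := exists_fresh f g [sub (lam LF.top) (lam E)]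
  refine Provable.funExt n (hn σ).1 (hn σ).2.1 (hn σ).2.2 ?_
  rw [← e]
  refine (Provable.univInst (a := fvar σ n) (Provable.ax _ _) ?_).beta (BetaEq.beta E _)
  exact (Provable.top_intro _).beta (BetaEq.symm (BetaEq.beta LF.top (fvar σ n)))

/-! ### The term model of a Henkin theory -/

variable (M)

/-- Provable identity in the theory. -/
def setoid (σ : Ty) : Setoid (Term σ) where
  r a b := eq a b ∈ M.carrier
  iseqv := ⟨mem_eq_refl, mem_eq_symm, mem_eq_trans⟩

/-- The domain of type `σ`: terms of type `σ`, up to identity in the theory. -/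
def D (σ : Ty) : Type := Quotient (M.setoid σ)

variable {M}

/-- The object denoted by a term. -/
def cls (a : Term σ) : M.D σ := Quotient.mk (M.setoid σ) a

/-- A term denoting the given object. -/
noncomputable def D.rep (d : M.D σ) : Term σ := Quotient.out d

@[simp] theorem cls_rep (d : M.D σ) : cls d.rep = d := Quotient.out_eq d

theorem cls_eq_cls {a b : Term σ} : (cls a : M.D σ) = cls b ↔ eq a b ∈ M.carrier := Quotient.eq

/-- Application in the term model. -/
def D.ap (f : M.D (σ ⇒ τ)) (a : M.D σ) : M.D τ :=
  Quotient.map₂ Tm.app (fun _ _ h _ _ h' => mem_eq_app h h') f a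

/-- Application in the term model. -/
infixl:90 " ⬝ " => D.ap

/-- Truth in the term model. -/
def D.T (p : M.D t) : Prop :=
  Quotient.lift (· ∈ M.carrier) (fun _ _ h => propext (mem_iff_of_mem_eq h)) p

theorem cls_app (f : Term (σ ⇒ τ)) (a : Term σ) : (cls (app f a) : M.D τ) = cls f ⬝ cls a := rfl

theorem T_cls (P : Formula) : (cls P : M.D t).T ↔ P ∈ M.carrier := Iff.rfl

theorem D.ext {f g : M.D (σ ⇒ τ)} (h : ∀ a, f ⬝ a = g ⬝ a) : f = g := by
  rw [← cls_rep f, ← cls_rep g, cls_eq_cls]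
  refine mem_eq_ext fun a => ?_
  rw [← cls_eq_cls, cls_app, cls_app, cls_rep, cls_rep, h]

variable (M) in
/-- Assignments of objects to the variables bound by the enclosing abstractions. -/
abbrev Env (Δ : List Ty) : Type := ∀ σ : Ty, Idx Δ σ → M.D σ

/-- The empty assignment. -/
def Env.nil : M.Env [] := fun _ i => nomatch i

/-- Extend an assignment by a value for the innermost variable. -/
def Env.cons (d : M.D σ) (r : M.Env Δ) : M.Env (σ :: Δ)
  | _, Idx.zero => d
  | _, Idx.succ i => r _ i

/-- Denotation of a term under an assignment. -/
noncomputable def den (A : Tm Δ σ) (r : M.Env Δ) : M.D σ := cls (subst (fun τ i => (r τ i).rep) A)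

@[simp] theorem den_bvar (i : Idx Δ σ) (r : M.Env Δ) : den (bvar i) r = r σ i := cls_rep _

@[simp] theorem den_app (f : Tm Δ (σ ⇒ τ)) (a : Tm Δ σ) (r : M.Env Δ) :
    den (app f a) r = den f r ⬝ den a r := (rfl)

@[simp] theorem den_lam (A : Tm (σ :: Δ) τ) (r : M.Env Δ) (d : M.D σ) :
    den (lam A) r ⬝ d = den A (r.cons d) := by
  conv_lhs => rw [← cls_rep d]
  rw [den, den, ← cls_app, cls_eq_cls]
  have e : subst (fun τ i => (Env.cons d r τ i).rep) A
      = inst (subst (liftSub fun τ i => (r τ i).rep) A) d.rep := by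
    rw [inst_subst_liftSub]
    congr 1
    funext τ i; cases i <;> rfl
  rw [e]
  exact mem_eq_of_betaEq (BetaEq.beta _ _)

theorem den_nil (A : Term σ) : den A (Env.nil : M.Env []) = cls A := by rw [den, subst_nil]

theorem den_rename (ren : ∀ σ : Ty, Idx Δ σ → Idx Δ' σ) (A : Tm Δ σ) (r : M.Env Δ') :
    den (rename ren A) r = den A (fun τ i => r τ (ren τ i)) := by
  induction A generalizing Δ' with
  | bvar i => simp only [rename, den_bvar]
  | fvar σ n => rfl
  | incl σ => rfl
  | app f a ihf iha => simp only [rename, den_app, ihf, iha]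
  | lam a ih =>
    refine D.ext fun d => ?_
    simp only [rename, den_lam, ih]
    congr 1
    funext τ i; cases i <;> rfl

@[simp] theorem den_wk (A : Tm Δ σ) (r : M.Env Δ) (d : M.D τ) : den (wk A) (r.cons d) = den A r :=
  den_rename _ _ _

theorem den_subst (s : ∀ σ : Ty, Idx Δ σ → Tm Δ' σ) (A : Tm Δ σ) (r : M.Env Δ') :
    den (subst s A) r = den A (fun τ i => den (s τ i) r) := by
  induction A generalizing Δ' with
  | bvar i => simp only [subst, den_bvar]
  | fvar σ n => rfl
  | incl σ => rfl
  | app f a ihf iha => simp only [subst, den_app, ihf, iha]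
  | lam a ih =>
    refine D.ext fun d => ?_
    simp only [subst, den_lam, ih]
    congr 1
    funext τ i; cases i
    · exact den_bvar _ _
    · exact den_wk _ _ _

@[simp] theorem T_sub (F G : Tm Δ (σ ⇒ t)) (r : M.Env Δ) :
    (den (sub F G) r).T ↔ ∀ d, (den F r ⬝ d).T → (den G r ⬝ d).T := by
  refine Iff.trans (mem_sub (F := subst _ F) (G := subst _ G)) ⟨fun h d => ?_, fun h a => h (cls a)⟩
  rw [← cls_rep d]
  exact h d.rep

/-! ### Completeness, and what holds in all models -/

/-- Completeness: what holds in all Henkin theories is provable. -/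
theorem provable_of_forall_T {P : Formula} (h : ∀ M : Henkin, (den P (Env.nil : M.Env [])).T) :
    Provable [] P := by
  by_contra hn
  obtain ⟨M, -, hM⟩ := exists_henkin hn
  refine hM ?_
  have := h M
  rwa [den_nil, T_cls] at this

/-- Intensionality for the models: propositions that are materially equivalent in all models,
whatever the parameters, are identical in all models. -/
theorem den_congr {A B : Tm Δ t} (h : ∀ (M : Henkin) (r : M.Env Δ), (den A r).T ↔ (den B r).T)
    (r : M.Env Δ) : den A r = den B r := by
  have key : ∀ (A B : Tm Δ t), (∀ (M : Henkin) (r : M.Env Δ), (den A r).T ↔ (den B r).T) →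
      ∀ s : (∀ σ : Ty, Idx Δ σ → Term σ), Provable [subst s A] (subst s B) := by
    intro A B h s
    by_contra hn
    obtain ⟨N, hN, hN'⟩ := exists_henkin hn
    refine hN' ?_
    rw [← T_cls, ← den_nil, den_subst, ← h N, ← den_subst, den_nil, T_cls]
    exact hN _ (by simp)
  exact cls_eq_cls.2 (mem_of_provable
    (Provable.intens (key A B h _) (key B A (fun M r => (h M r).symm) _)))

end Henkin

namespace Henkin

/-! ### Truth conditions of the logical vocabulary -/

variable {M : Henkin} {Δ : List Ty} {σ τ ρ κ : Ty}

@[simp] theorem Env.cons_zero (d : M.D σ) (r : M.Env Δ) : r.cons d σ Idx.zero = d := rfl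

@[simp] theorem Env.cons_succ (d : M.D σ) (r : M.Env Δ) (i : Idx Δ τ) :
    r.cons d τ (Idx.succ i) = r τ i := rfl

@[simp] theorem den_v0 (r : M.Env (σ :: Δ)) : den v0 r = r σ Idx.zero := den_bvar _ _

@[simp] theorem den_v1 (r : M.Env (τ :: σ :: Δ)) : den v1 r = r σ (Idx.succ Idx.zero) :=
  den_bvar _ _

@[simp] theorem den_v2 (r : M.Env (ρ :: τ :: σ :: Δ)) :
    den v2 r = r σ (Idx.succ (Idx.succ Idx.zero)) := den_bvar _ _

@[simp] theorem den_v3 (r : M.Env (κ :: ρ :: τ :: σ :: Δ)) :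
    den v3 r = r σ (Idx.succ (Idx.succ (Idx.succ Idx.zero))) := den_bvar _ _

noncomputable instance : Top (M.D t) := ⟨den LF.top Env.nil⟩
noncomputable instance : Bot (M.D t) := ⟨den LF.bot Env.nil⟩
noncomputable instance : Min (M.D t) := ⟨fun p q => den andC Env.nil ⬝ p ⬝ q⟩
noncomputable instance : Max (M.D t) := ⟨fun p q => den orC Env.nil ⬝ p ⬝ q⟩
noncomputable instance : Compl (M.D t) := ⟨fun p => den negC Env.nil ⬝ p⟩
noncomputable instance : HImp (M.D t) := ⟨fun p q => den impC Env.nil ⬝ p ⬝ q⟩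

/-- The proposition that everything has the property. -/
noncomputable def D.all (F : M.D (σ ⇒ t)) : M.D t := den allC Env.nil ⬝ F
/-- The proposition that something has the property. -/
noncomputable def D.ex (F : M.D (σ ⇒ t)) : M.D t := den exC Env.nil ⬝ F
/-- The proposition that two objects are identical. -/
noncomputable def D.eqv (a b : M.D σ) : M.D t := den eqC Env.nil ⬝ a ⬝ b

@[simp] theorem den_top (r : M.Env Δ) : den LF.top r = ⊤ := (rfl)
@[simp] theorem den_bot (r : M.Env Δ) : den LF.bot r = ⊥ := (rfl)
@[simp] theorem den_allC (r : M.Env Δ) (F : M.D (σ ⇒ t)) : den allC r ⬝ F = F.all := (rfl)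
@[simp] theorem den_exC (r : M.Env Δ) (F : M.D (σ ⇒ t)) : den exC r ⬝ F = F.ex := (rfl)

@[simp] theorem den_neg (P : Tm Δ t) (r : M.Env Δ) : den (neg P) r = (den P r)ᶜ := (rfl)
@[simp] theorem den_and (P Q : Tm Δ t) (r : M.Env Δ) : den (and P Q) r = den P r ⊓ den Q r := (rfl)
@[simp] theorem den_or (P Q : Tm Δ t) (r : M.Env Δ) : den (or P Q) r = den P r ⊔ den Q r := (rfl)
@[simp] theorem den_imp (P Q : Tm Δ t) (r : M.Env Δ) : den (imp P Q) r = den P r ⇨ den Q r := (rfl)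
@[simp] theorem den_all (P : Tm (σ :: Δ) t) (r : M.Env Δ) :
    den (all P) r = D.all (den (lam P) r) := (rfl)
@[simp] theorem den_ex (P : Tm (σ :: Δ) t) (r : M.Env Δ) :
    den (ex P) r = D.ex (den (lam P) r) := (rfl)
@[simp] theorem den_eq (a b : Tm Δ σ) (r : M.Env Δ) :
    den (eq a b) r = (den a r).eqv (den b r) := (rfl)
@[simp] theorem den_ne (a b : Tm Δ σ) (r : M.Env Δ) :
    den (ne a b) r = ((den a r).eqv (den b r))ᶜ := by
  simp [ne, neC]

@[simp] theorem T_top : (⊤ : M.D t).T :=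
  (T_sub (lam v0) (lam v0) (Env.nil : M.Env [])).2 fun _ => id

@[simp] theorem not_T_bot : ¬ (⊥ : M.D t).T := M.consistent

@[simp] theorem T_compl (p : M.D t) : (pᶜ).T ↔ ¬ p.T := by
  have h : pᶜ = den (sub (σ := t) (lam v1) (lam LF.bot)) (Env.nil.cons p) := den_lam _ _ _
  rw [h, T_sub]
  simp only [den_lam, den_v1, Env.cons_succ, Env.cons_zero, den_bot, not_T_bot]
  exact ⟨fun h => h p, fun h _ => h⟩

@[simp] theorem T_himp (p q : M.D t) : (p ⇨ q).T ↔ (p.T → q.T) := by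
  have h : p ⇨ q = den (sub (σ := t) (lam v2) (lam v1)) ((Env.nil.cons p).cons q) := by
    rw [← den_lam, ← den_lam]; rfl
  rw [h, T_sub]
  simp only [den_lam, den_v1, den_v2, Env.cons_succ, Env.cons_zero]
  exact ⟨fun h => h p, fun h _ => h⟩

@[simp] theorem T_sup (p q : M.D t) : (p ⊔ q).T ↔ p.T ∨ q.T := by
  have h : p ⊔ q = den (imp (neg v1) v0) ((Env.nil.cons p).cons q) := by
    rw [← den_lam, ← den_lam]; rfl
  rw [h]
  simp [or_iff_not_imp_left]

@[simp] theorem T_inf (p q : M.D t) : (p ⊓ q).T ↔ p.T ∧ q.T := by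
  have h : p ⊓ q = den (neg (or (neg v1) (neg v0))) ((Env.nil.cons p).cons q) := by
    rw [← den_lam, ← den_lam]; rfl
  rw [h]
  simp

@[simp] theorem T_all (F : M.D (σ ⇒ t)) : F.all.T ↔ ∀ d, (F ⬝ d).T := by
  have h : F.all = den (sub (lam LF.top) v0) (Env.nil.cons F) := den_lam _ _ _
  rw [h]
  simp

@[simp] theorem T_ex (F : M.D (σ ⇒ t)) : F.ex.T ↔ ∃ d, (F ⬝ d).T := by
  have h : F.ex = den (neg (all (neg (app v1 v0)))) (Env.nil.cons F) := den_lam _ _ _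
  rw [h]
  simp

@[simp] theorem T_eqv (a b : M.D σ) : (a.eqv b).T ↔ a = b := by
  rw [← cls_rep a, ← cls_rep b, cls_eq_cls]
  rfl

/-! ### The Boolean algebra of propositions -/

/-- The Boolean algebra of propositions. The order is that of the formal language: `p ≤ q` when the
conjunction of `p` and `q` is `p`. Every law is an instance of intensionality. -/
noncomputable instance : BooleanAlgebra (M.D t) where
  le p q := p ⊓ q = p
  le_refl p := by
    simpa using den_congr (A := and v0 v0) (B := v0) (by simp) (Env.nil.cons p)
  le_trans p q r h h' := by
    have h3 : (p ⊓ q) ⊓ r = p ⊓ (q ⊓ r) := by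
      simpa using den_congr (A := and (and v2 v1) v0) (B := and v2 (and v1 v0))
        (by simp [and_assoc]) (((Env.nil.cons p).cons q).cons r)
    change p ⊓ r = p
    change p ⊓ q = p at h
    change q ⊓ r = q at h'
    rw [← h, h3, h']
  le_antisymm p q h h' := by
    have h3 : p ⊓ q = q ⊓ p := by
      simpa using den_congr (A := and v1 v0) (B := and v0 v1)
        (by simp [and_comm]) ((Env.nil.cons p).cons q)
    exact (h.symm.trans h3).trans h'
  inf := (· ⊓ ·)
  sup := (· ⊔ ·)
  top := ⊤
  bot := ⊥
  compl p := pᶜ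
  himp := (· ⇨ ·)
  inf_le_left p q := by
    simpa using den_congr (A := and (and v1 v0) v1) (B := and v1 v0)
      (by simp; tauto) ((Env.nil.cons p).cons q)
  inf_le_right p q := by
    simpa using den_congr (A := and (and v1 v0) v0) (B := and v1 v0)
      (by simp) ((Env.nil.cons p).cons q)
  le_inf p q r h h' := by
    have h3 : (p ⊓ q) ⊓ r = p ⊓ (q ⊓ r) := by
      simpa using den_congr (A := and (and v2 v1) v0) (B := and v2 (and v1 v0))
        (by simp [and_assoc]) (((Env.nil.cons p).cons q).cons r)
    change p ⊓ q = p at h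
    change p ⊓ r = p at h'
    change p ⊓ (q ⊓ r) = p
    rw [← h3, h, h']
  le_sup_left p q := by
    simpa using den_congr (A := and v1 (or v1 v0)) (B := v1)
      (by simp; tauto) ((Env.nil.cons p).cons q)
  le_sup_right p q := by
    simpa using den_congr (A := and v0 (or v1 v0)) (B := v0)
      (by simp; tauto) ((Env.nil.cons p).cons q)
  sup_le p q r h h' := by
    have h3 : (p ⊔ q) ⊓ r = (p ⊓ r) ⊔ (q ⊓ r) := by
      simpa using den_congr (A := and (or v2 v1) v0) (B := or (and v2 v0) (and v1 v0))
        (by simp [or_and_right]) (((Env.nil.cons p).cons q).cons r)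
    change p ⊓ r = p at h
    change q ⊓ r = q at h'
    change (p ⊔ q) ⊓ r = p ⊔ q
    rw [h3, h, h']
  le_sup_inf p q r := by
    simpa using den_congr
      (A := and (and (or v2 v1) (or v2 v0)) (or v2 (and v1 v0))) (B := and (or v2 v1) (or v2 v0))
      (by simp; tauto) (((Env.nil.cons p).cons q).cons r)
  inf_compl_le_bot p := by
    simpa using den_congr (A := and (and v0 (neg v0)) LF.bot) (B := and v0 (neg v0))
      (by simp) (Env.nil.cons p)
  top_le_sup_compl p := by
    simpa using den_congr (A := and LF.top (or v0 (neg v0))) (B := LF.top)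
      (by simp [em]) (Env.nil.cons p)
  le_top p := by
    simpa using den_congr (A := and v0 LF.top) (B := v0) (by simp) (Env.nil.cons p)
  bot_le p := by
    simpa using den_congr (A := and LF.bot v0) (B := LF.bot) (by simp) (Env.nil.cons p)
  himp_eq p q := by
    simpa using den_congr (A := imp v1 v0) (B := or v0 (neg v1))
      (by simp; tauto) ((Env.nil.cons p).cons q)

theorem le_iff_inf_eq {p q : M.D t} : p ≤ q ↔ p ⊓ q = p := Iff.rfl

/-- What follows in all models, whatever the parameters, is entailed. -/
theorem den_le_den {A B : Tm Δ t} (h : ∀ (M : Henkin) (r : M.Env Δ), (den A r).T → (den B r).T)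
    (r : M.Env Δ) : den A r ≤ den B r :=
  den_congr (A := and A B) (B := A) (fun M r => by simpa using h M r) r

theorem den_eq_top {A : Tm Δ t} (h : ∀ (M : Henkin) (r : M.Env Δ), (den A r).T)
    (r : M.Env Δ) : den A r = ⊤ :=
  den_congr (B := LF.top) (fun M r => by simpa using h M r) r

@[simp] theorem den_leC (r : M.Env Δ) (p q : M.D t) : den leC r ⬝ p ⬝ q = (p ⊓ q).eqv p := by
  simp [leC]

@[simp] theorem den_le (P Q : Tm Δ t) (r : M.Env Δ) :
    den (le P Q) r = (den P r ⊓ den Q r).eqv (den P r) := by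
  simp [le]

@[simp] theorem T_le (p q : M.D t) : ((p ⊓ q).eqv p).T ↔ p ≤ q := by simp

/-! ### Quantifiers as infinite meets and joins -/

theorem all_le (F : M.D (σ ⇒ t)) (a : M.D σ) : F.all ≤ F ⬝ a := by
  simpa using den_le_den (A := app allC v1) (B := app v1 v0) (by simp +contextual)
    ((Env.nil.cons F).cons a)

theorem le_ex (F : M.D (σ ⇒ t)) (a : M.D σ) : F ⬝ a ≤ F.ex := by
  simpa using den_le_den (A := app v1 v0) (B := app exC v1) (fun M r h => by
    simp only [den_app, den_exC, T_ex] at h ⊢; exact ⟨_, h⟩)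
    ((Env.nil.cons F).cons a)

/-- The Barcan formula: a universal generalization is the greatest lower bound of its instances,
because by function extensionality it is determined by them. -/
theorem le_all {p : M.D t} {F : M.D (σ ⇒ t)} (h : ∀ a, p ≤ F ⬝ a) : p ≤ F.all := by
  have h1 : den (all (σ := σ) (and v2 (app v1 v0))) ((Env.nil.cons p).cons F) ≤ F.all := by
    simpa using den_le_den (A := all (σ := σ) (and v2 (app v1 v0))) (B := app allC v0)
      (by simp +contextual) ((Env.nil.cons p).cons F)
  refine le_trans ?_ h1
  have h2 : den (lam (σ := σ) (and v2 (app v1 v0))) ((Env.nil.cons p).cons F)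
      = den (lam (σ := σ) v1) (Env.nil.cons p) := D.ext fun a => by simpa using h a
  rw [den_all, h2]
  simpa using den_le_den (A := v0) (B := all (σ := σ) v1) (by simp +contextual)
    (Env.nil.cons p)

theorem ex_le {p : M.D t} {F : M.D (σ ⇒ t)} (h : ∀ a, F ⬝ a ≤ p) : F.ex ≤ p := by
  have h1 : F.ex = (D.all (den (lam (neg (app v1 v0))) (Env.nil.cons F)))ᶜ := by
    simpa using den_congr (A := app exC v0) (B := neg (all (neg (app v1 v0))))
      (by simp) (Env.nil.cons F)
  rw [h1, compl_le_iff_compl_le]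
  exact le_all fun a => by simpa using compl_le_compl (h a)

theorem all_eq_top {F : M.D (σ ⇒ t)} (h : ∀ a, F ⬝ a = ⊤) : F.all = ⊤ :=
  top_le_iff.1 (le_all fun a => (h a).ge)

/-- A proposition compatible with an existential generalization is compatible with one of its
instances. -/
theorem exists_inf_ne_bot {p : M.D t} {F : M.D (σ ⇒ t)} (h : p ⊓ F.ex ≠ ⊥) :
    ∃ a, p ⊓ F ⬝ a ≠ ⊥ := by
  by_contra! hn
  refine h ?_
  rw [← disjoint_iff, ← le_compl_iff_disjoint_left]
  exact ex_le fun a => by rw [le_compl_iff_disjoint_left, disjoint_iff]; exact hn a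


/-! ### Choice and classes -/

theorem exists_choice (R : M.D (σ ⇒ τ ⇒ t)) (h : ∀ x, ∃ y, (R ⬝ x ⬝ y).T) :
    ∃ f : M.D (σ ⇒ τ), ∀ x, (R ⬝ x ⬝ (f ⬝ x)).T := by
  have e : den R.rep (Env.nil : M.Env []) = R := by rw [den_nil, cls_rep]
  have h1 : all (σ := σ) (ex (σ := τ) (app (app (wk (wk R.rep)) v1) v0)) ∈ M.carrier := by
    rw [← T_cls, ← den_nil]
    simpa [e] using h
  have h2 := mem_of_provable₁ h1 (Provable.choice (Provable.ax _ _))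
  rw [← T_cls, ← den_nil] at h2
  simpa [e] using h2

/-- Every property is coextensive with a class, that is, with a function all of whose values are
`⊤` or `⊥`. -/
theorem exists_class (X : M.D (σ ⇒ t)) :
    ∃ C : M.D (σ ⇒ t), (∀ x, C ⬝ x = ⊤ ∨ C ⬝ x = ⊥) ∧ ∀ x, (C ⬝ x).T ↔ (X ⬝ x).T := by
  obtain ⟨C, hC⟩ := exists_choice (den (lam (lam (or (and (app v2 v1) (eq v0 LF.top))
    (and (neg (app v2 v1)) (eq v0 LF.bot))))) (Env.nil.cons X)) (fun x => by
      by_cases hx : (X ⬝ x).T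
      · exact ⟨⊤, by simp [hx]⟩
      · exact ⟨⊥, by simp [hx]⟩)
  simp only [den_lam, den_or, den_and, den_neg, den_app, den_eq, den_v0, den_v1, den_v2,
    Env.cons_zero, Env.cons_succ, den_top, den_bot, T_sup, T_inf, T_compl, T_eqv] at hC
  refine ⟨C, fun x => (hC x).imp And.right And.right, fun x => ?_⟩
  rcases hC x with ⟨h, h'⟩ | ⟨h, h'⟩ <;> simp [h, h']

/-! ### Rigid propositions -/

/-- A proposition is rigid if it is necessary or impossible. -/
def D.Rigid (p : M.D t) : Prop := p = ⊤ ∨ p = ⊥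

namespace D.Rigid

theorem eq_top {p : M.D t} (h : p.Rigid) (hp : p.T) : p = ⊤ :=
  h.resolve_right fun h => not_T_bot (h ▸ hp)

theorem eq_bot {p : M.D t} (h : p.Rigid) (hp : ¬ p.T) : p = ⊥ :=
  h.resolve_left fun h => hp (h ▸ T_top)

theorem T_of_ne_bot {p : M.D t} (h : p.Rigid) (hp : p ≠ ⊥) : p.T :=
  h.resolve_right hp ▸ T_top

theorem compl {p : M.D t} (h : p.Rigid) : (pᶜ).Rigid := by
  rcases h with rfl | rfl <;> simp [Rigid]

theorem inf {p q : M.D t} (h : p.Rigid) (h' : q.Rigid) : (p ⊓ q).Rigid := by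
  rcases h with rfl | rfl
  · simpa using h'
  · simp [Rigid]

theorem sup {p q : M.D t} (h : p.Rigid) (h' : q.Rigid) : (p ⊔ q).Rigid := by
  rcases h with rfl | rfl
  · simp [Rigid]
  · simpa using h'

theorem himp {p q : M.D t} (h : p.Rigid) (h' : q.Rigid) : (p ⇨ q).Rigid := by
  rw [himp_eq]; exact h'.sup h.compl

theorem all {F : M.D (σ ⇒ t)} (h : ∀ a, (F ⬝ a).Rigid) : F.all.Rigid := by
  by_cases hF : ∀ a, (F ⬝ a).T
  · exact Or.inl (all_eq_top fun a => (h a).eq_top (hF a))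
  · push Not at hF
    obtain ⟨a, ha⟩ := hF
    exact Or.inr (le_bot_iff.1 ((all_le F a).trans ((h a).eq_bot ha).le))

/-- Identity and distinctness are necessary. If `C` is a class coextensive with being `a`, then
`a = b` entails `C b` necessarily, so that it is impossible when `C b` is `⊥`. -/
theorem eqv (a b : M.D σ) : (a.eqv b).Rigid := by
  by_cases hab : a = b
  · subst hab
    left
    simpa using den_eq_top (A := eq v0 v0) (by simp) (Env.nil.cons a)
  · right
    obtain ⟨C, hC, hC'⟩ := exists_class (den (lam (eq v1 v0)) (Env.nil.cons a))
    simp only [den_lam, den_eq, den_v0, den_v1, Env.cons_zero, Env.cons_succ, T_eqv] at hC'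
    have ha : C ⬝ a = ⊤ := eq_top (hC a) ((hC' a).2 rfl)
    have hb : C ⬝ b = ⊥ := eq_bot (hC b) fun h => hab ((hC' b).1 h)
    have := den_le_den (A := and (eq v2 v1) (app v0 v2)) (B := app v0 v1)
      (fun M r h => by
        simp only [den_and, den_eq, den_app, den_v0, den_v1, den_v2, T_inf, T_eqv] at h ⊢
        exact h.1 ▸ h.2) (((Env.nil.cons a).cons b).cons C)
    simpa [ha, hb] using this

theorem congr {p q : M.D t} (hp : p.Rigid) (hq : q.Rigid) (h : p.T ↔ q.T) : p = q := by
  by_cases hT : p.T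
  · rw [hp.eq_top hT, hq.eq_top (h.1 hT)]
  · rw [hp.eq_bot hT, hq.eq_bot fun h' => hT (h.2 h')]

end D.Rigid

/-! ### Completeness and atomicity -/

/-- The meet of the members of a class of propositions. -/
noncomputable def D.meet (C : M.D (t ⇒ t)) : M.D t :=
  D.all (den (lam (imp (app v1 v0) v0)) (Env.nil.cons C))

theorem meet_le {C : M.D (t ⇒ t)} {p : M.D t} (h : C ⬝ p = ⊤) : C.meet ≤ p :=
  (all_le _ p).trans (by simp [h])

theorem le_meet {C : M.D (t ⇒ t)} (hC : ∀ p, (C ⬝ p).Rigid) {u : M.D t}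
    (h : ∀ p, (C ⬝ p).T → u ≤ p) : u ≤ C.meet := by
  refine le_all fun p => ?_
  by_cases hp : (C ⬝ p).T
  · simpa [(hC p).eq_top hp] using h p hp
  · simp [(hC p).eq_bot hp]

/-- A property of propositions need not hold rigidly of its instances, but it has the same
instances as some class, and the meet of the class is its greatest lower bound. -/
theorem exists_isGLB (X : M.D (t ⇒ t)) : ∃ u, IsGLB {p | (X ⬝ p).T} u := by
  obtain ⟨C, hC, hC'⟩ := exists_class X
  exact ⟨C.meet, fun p hp => meet_le (D.Rigid.eq_top (hC p) ((hC' p).2 hp)),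
    fun u hu => le_meet hC fun p hp => hu ((hC' p).1 hp)⟩

theorem exists_isLUB (X : M.D (t ⇒ t)) : ∃ u, IsLUB {p | (X ⬝ p).T} u := by
  obtain ⟨u, hu⟩ := exists_isGLB (den (lam (app v1 (neg v0))) (Env.nil.cons X))
  refine ⟨uᶜ, fun p hp => ?_, fun v hv => ?_⟩
  · rw [le_compl_comm]
    exact hu.1 (by simpa using hp)
  · rw [compl_le_iff_compl_le]
    refine hu.2 fun p hp => ?_
    rw [compl_le_iff_compl_le]
    exact hv (by simpa using hp)

/-- The meet of all true propositions is a true atom. -/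
theorem exists_true_atom (M : Henkin) : ∃ a : M.D t, IsAtom a ∧ a.T := by
  obtain ⟨C, hC, hC'⟩ := exists_class (den (lam v0) (Env.nil : M.Env []))
  simp only [den_lam, den_v0, Env.cons_zero] at hC'
  have hT : C.meet.T := by simpa [D.meet] using fun d => (hC' d).1
  have hle : ∀ p : M.D t, p.T → C.meet ≤ p := fun p hp =>
    meet_le (D.Rigid.eq_top (hC p) ((hC' p).2 hp))
  refine ⟨C.meet, ⟨fun h => not_T_bot (h ▸ hT), fun q hq => ?_⟩, hT⟩
  have hn : ¬ q.T := fun h => hq.not_ge (hle q h)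
  exact le_compl_self.1 (hq.le.trans (hle _ ((T_compl q).2 hn)))

theorem T_atomC (r : M.Env Δ) (a : M.D t) : (den atomC r ⬝ a).T ↔ IsAtom a := by
  simp only [atomC, den_lam, den_and, den_ne, den_all, den_imp, den_le, den_or, den_eq, den_v0,
    den_v1, Env.cons_zero, Env.cons_succ, den_bot, T_inf, T_compl, T_eqv, T_all, T_himp, T_sup,
    ← le_iff_inf_eq, IsAtom, lt_iff_le_and_ne]
  refine and_congr_right fun _ => forall_congr' fun q => ?_
  tauto

theorem rigid_atomC (r : M.Env Δ) (a : M.D t) : (den atomC r ⬝ a).Rigid := by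
  simp only [atomC, den_lam, den_and, den_ne, den_all, den_v0, Env.cons_zero, den_bot]
  refine (D.Rigid.eqv _ _).compl.inf (D.Rigid.all fun q => ?_)
  simp only [den_lam, den_imp, den_le, den_or, den_eq, den_v0,
    den_v1, Env.cons_zero, Env.cons_succ, den_bot]
  exact (D.Rigid.eqv _ _).himp ((D.Rigid.eqv _ _).sup (D.Rigid.eqv _ _))

/-- It is necessary that there is a true atom, and being an atom is rigid. So a possible proposition
is compatible with, hence entailed by, some atom. -/
instance : IsAtomic (M.D t) where
  eq_bot_or_exists_atom_le p := by
    by_cases hp : p = ⊥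
    · exact Or.inl hp
    right
    have htop : den (ex (and (app atomC v0) v0)) (Env.nil : M.Env []) = ⊤ :=
      den_eq_top (fun M r => by simpa [T_atomC] using exists_true_atom M) _
    obtain ⟨a, ha⟩ := exists_inf_ne_bot (p := p)
      (F := den (lam (and (app atomC v0) v0)) (Env.nil : M.Env [])) (by
        rw [den_ex] at htop
        rwa [htop, inf_top_eq])
    simp only [den_lam, den_and, den_app, den_v0, Env.cons_zero] at ha
    have h1 : (den atomC (Env.cons a Env.nil) ⬝ a).T := (rigid_atomC _ _).T_of_ne_bot fun h => by
      simp [h] at ha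
    have h2 := (T_atomC _ _).1 h1
    refine ⟨a, h2, ?_⟩
    by_contra hle
    rw [(rigid_atomC _ _).eq_top h1, top_inf_eq] at ha
    exact hle (inf_eq_right.1 ((h2.le_iff.1 inf_le_right).resolve_left ha))

theorem T_booleanAlgebra (r : M.Env []) : (den booleanAlgebra r).T := by
  simp only [booleanAlgebra, den_and, den_all, den_eq, den_or, den_neg, den_ne, den_top, den_bot,
    T_inf, T_all, den_lam, T_eqv, den_v0, den_v1, den_v2, Env.cons_zero, Env.cons_succ, T_compl]
  refine ⟨fun _ _ => inf_comm _ _, fun _ _ => sup_comm _ _, fun _ _ _ => inf_assoc _ _ _,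
    fun _ _ _ => sup_assoc _ _ _, fun _ _ => inf_sup_self, fun _ _ => sup_inf_self,
    fun _ _ _ => inf_sup_left _ _ _, fun _ _ _ => sup_inf_left _ _ _, fun _ => inf_top_eq _,
    fun _ => sup_bot_eq _, fun _ => inf_compl_eq_bot, fun _ => sup_compl_eq_top, fun h => ?_⟩
  exact not_T_bot (h ▸ T_top)

theorem T_complete (r : M.Env []) : (den complete r).T := by
  simp only [complete, upperC, lowerC, den_and, den_all, den_ex, den_imp, den_app, den_le, T_inf,
    T_all, T_ex, T_himp, den_lam, T_eqv, den_v0, den_v1, den_v2, Env.cons_zero, Env.cons_succ,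
    ← le_iff_inf_eq]
  intro X
  obtain ⟨u, hu⟩ := exists_isLUB X
  obtain ⟨l, hl⟩ := exists_isGLB X
  exact ⟨⟨u, fun p hp => hu.1 hp, fun v hv => hu.2 fun p hp => hv p hp⟩,
    ⟨l, fun p hp => hl.1 hp, fun v hv => hl.2 fun p hp => hv p hp⟩⟩

theorem T_atomic (r : M.Env []) : (den atomic r).T := by
  simp only [atomic, den_and, den_all, den_ex, den_imp, den_app, den_le, den_ne, T_inf, T_all,
    T_ex, T_himp, T_compl, den_lam, T_eqv, den_v0, den_v1, Env.cons_zero, Env.cons_succ, den_bot,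
    ← le_iff_inf_eq, T_atomC]
  exact fun p hp => (eq_bot_or_exists_atom_le p).resolve_left hp

end Henkin

theorem closed_completeAtomicBooleanAlgebra : completeAtomicBooleanAlgebra.Closed := by
  intro ρ n h
  revert h
  simp [completeAtomicBooleanAlgebra, booleanAlgebra, complete, atomic, and, andC, or, orC, neg,
    negC, imp, impC, all, allC, ex, exC, eq, eqC, ne, neC, LF.top, LF.bot, sub, le, leC, upperC,
    lowerC, atomC, v0, v1, v2, Occurs]

theorem isTheorem_completeAtomicBooleanAlgebra : IsTheorem completeAtomicBooleanAlgebra := by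
  refine ⟨closed_completeAtomicBooleanAlgebra, Henkin.provable_of_forall_T fun M => ?_⟩
  rw [completeAtomicBooleanAlgebra, Henkin.den_and, Henkin.den_and, Henkin.T_inf, Henkin.T_inf]
  exact ⟨Henkin.T_booleanAlgebra _, Henkin.T_complete _, Henkin.T_atomic _⟩

namespace Henkin

variable {M : Henkin} {Δ : List Ty} {σ τ ρ κ μ ν : Ty}

/-! ### Numerals -/

/-- The variable bound by the fourth abstraction outwards from the innermost one; similarly for
`v5`. -/
def v4 : Tm (μ :: κ :: ρ :: τ :: σ :: Δ) σ :=
  bvar (Idx.succ (Idx.succ (Idx.succ (Idx.succ Idx.zero))))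
def v5 : Tm (ν :: μ :: κ :: ρ :: τ :: σ :: Δ) σ :=
  bvar (Idx.succ (Idx.succ (Idx.succ (Idx.succ (Idx.succ Idx.zero)))))

@[simp] theorem den_v4 (r : M.Env (μ :: κ :: ρ :: τ :: σ :: Δ)) :
    den v4 r = r σ (Idx.succ (Idx.succ (Idx.succ (Idx.succ Idx.zero)))) := den_bvar _ _

@[simp] theorem den_v5 (r : M.Env (ν :: μ :: κ :: ρ :: τ :: σ :: Δ)) :
    den v5 r = r σ (Idx.succ (Idx.succ (Idx.succ (Idx.succ (Idx.succ Idx.zero))))) := den_bvar _ _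

/-- The numeral zero. -/
noncomputable def zero : M.D (numTy σ) := den zeroC Env.nil
/-- The successor of a numeral. -/
noncomputable def D.succ (n : M.D (numTy σ)) : M.D (numTy σ) :=
  den addC Env.nil ⬝ n ⬝ den oneC Env.nil
/-- The proposition that `n` is a natural number. -/
noncomputable def D.nat (n : M.D (numTy σ)) : M.D t := den natC Env.nil ⬝ n

@[simp] theorem den_zeroC (r : M.Env Δ) : den zeroC r = zero (σ := σ) := (rfl)
@[simp] theorem den_add_oneC (n : Tm Δ (numTy σ)) (r : M.Env Δ) :
    den (add n oneC) r = (den n r).succ := (rfl)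
@[simp] theorem den_natC (r : M.Env Δ) (n : M.D (numTy σ)) : den natC r ⬝ n = n.nat := (rfl)

theorem T_zero (X : M.D (σ ⇒ t)) : (zero ⬝ X).T ↔ ∀ x, ¬ (X ⬝ x).T := by
  rw [zero, zeroC]
  simp

theorem T_succ (n : M.D (numTy σ)) (X : M.D (σ ⇒ t)) :
    (n.succ ⬝ X).T ↔ ∃ Y : M.D (σ ⇒ t), (∀ x, (Y ⬝ x).T → (X ⬝ x).T) ∧ (n ⬝ Y).T ∧
      ∃ y, ((X ⬝ y).T ∧ ¬ (Y ⬝ y).T) ∧ ∀ z, (X ⬝ z).T → ¬ (Y ⬝ z).T → y = z := by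
  rw [D.succ, addC, oneC, sdiffC]
  simp

theorem T_nat (n : M.D (numTy σ)) :
    n.nat.T ↔ ∀ X : M.D (numTy σ ⇒ t), (X ⬝ zero).T → (∀ m, (X ⬝ m).T → (X ⬝ m.succ).T) →
      (X ⬝ n).T := by
  rw [D.nat, natC]
  simp

theorem T_nat_zero : (zero (M := M) (σ := σ)).nat.T := (T_nat _).2 fun _ h _ => h

theorem T_nat_succ {n : M.D (numTy σ)} (h : n.nat.T) : n.succ.nat.T :=
  (T_nat _).2 fun X h0 hs => hs _ ((T_nat n).1 h X h0 hs)

/-- Being a natural number is necessary: the property of necessarily being a natural number holds of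
zero and is preserved under successor. -/
theorem nat_eq_top {n : M.D (numTy σ)} (h : n.nat.T) : n.nat = ⊤ := by
  have := (T_nat n).1 h (den (lam (eq (app natC v0) LF.top)) Env.nil)
  simp only [den_lam, den_eq, den_app, den_natC, den_v0, Env.cons_zero, den_top, T_eqv] at this
  refine this ?_ fun m hm => ?_
  · simpa using den_eq_top (A := app natC (zeroC (σ := σ)))
      (fun M r => by simpa using T_nat_zero) (Env.nil : M.Env [])
  · have h1 : m.nat ≤ m.succ.nat := by
      simpa using den_le_den (A := app natC v0) (B := app natC (add v0 oneC))
        (fun M r => by simpa using T_nat_succ) (Env.nil.cons m)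
    exact top_le_iff.1 (hm ▸ h1)

/-- Potential infinity in a Henkin theory. -/
theorem ex_ne_bot {n : M.D (numTy t)} (h : n.nat.T) : n.ex ≠ ⊥ := by
  have e : den n.rep (Env.nil : M.Env []) = n := by rw [den_nil, cls_rep]
  have h1 : app natC n.rep ∈ M.carrier := by
    rw [← T_cls, ← den_nil]
    simpa [e] using h
  have h2 := mem_of_provable₁ h1 (Provable.potInf (Or.inr rfl) (Provable.ax _ _))
  rw [← T_cls, ← den_nil] at h2
  simp only [den_ne, den_bot, den_app, den_exC, e, T_compl, T_eqv] at h2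
  exact fun h => h2 h.symm

/-! ### Bounded properties -/

/-- `λYxyz. (Yz ∧ z ≠ x) ∨ z = y`: replace `x` by `y` in `Y`. -/
def swapC : Tm Δ ((σ ⇒ t) ⇒ σ ⇒ σ ⇒ σ ⇒ t) :=
  lam (lam (lam (lam (or (and (app v3 v0) (ne v0 v2)) (eq v0 v1)))))

/-- The property `Y` with `x` replaced by `y`. -/
noncomputable def D.swap (Y : M.D (σ ⇒ t)) (x y : M.D σ) : M.D (σ ⇒ t) :=
  den swapC Env.nil ⬝ Y ⬝ x ⬝ y

@[simp] theorem den_swapC (r : M.Env Δ) (Y : M.D (σ ⇒ t)) (x y : M.D σ) :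
    den swapC r ⬝ Y ⬝ x ⬝ y = Y.swap x y := (rfl)

@[simp] theorem T_swap (Y : M.D (σ ⇒ t)) (x y z : M.D σ) :
    (Y.swap x y ⬝ z).T ↔ (Y ⬝ z).T ∧ z ≠ x ∨ z = y := by
  rw [D.swap, swapC]
  simp

/-- Replacing an element does not change the number of elements. -/
theorem T_num_swap {n : M.D (numTy σ)} (hn : n.nat.T) {Y : M.D (σ ⇒ t)} {x y : M.D σ}
    (hx : (Y ⬝ x).T) (hy : ¬ (Y ⬝ y).T) (hY : (n ⬝ Y).T) : (n ⬝ Y.swap x y).T := by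
  have := (T_nat n).1 hn (den (lam (all (all (all (imp (app v2 v1) (imp (neg (app v2 v0))
    (imp (app v3 v2) (app v3 (app (app (app swapC v2) v1) v0))))))))) Env.nil)
  simp only [den_lam, den_all, den_imp, den_neg, den_app, den_v0, den_v1, den_v2, den_v3,
    Env.cons_zero, Env.cons_succ, den_swapC, T_all, T_himp, T_compl] at this
  refine this (fun Y x _ hx _ h0 => ((T_zero Y).1 h0 x hx).elim) (fun m ih Y x y hx hy hY => ?_)
    Y x y hx hy hY
  obtain ⟨Z, hZ, hmZ, w, ⟨hw, hw'⟩, hu⟩ := (T_succ m Y).1 hY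
  rw [T_succ]
  by_cases hwx : w = x
  · subst hwx
    refine ⟨Z, fun z hz => ?_, hmZ, y, ⟨by simp, fun h => hy (hZ _ h)⟩, fun z hz hz' => ?_⟩
    · rw [T_swap]
      exact Or.inl ⟨hZ z hz, fun h => hw' (h ▸ hz)⟩
    · rcases (T_swap _ _ _ _).1 hz with ⟨h, h'⟩ | h
      · exact (h' (hu z h hz').symm).elim
      · exact h.symm
  · have hxZ : (Z ⬝ x).T := by
      by_contra h
      exact hwx (hu x hx h)
    refine ⟨Z.swap x y, fun z hz => ?_, ih Z x y hxZ (fun h => hy (hZ _ h)) hmZ, w,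
      ⟨?_, ?_⟩, fun z hz hz' => ?_⟩
    · rw [T_swap] at hz ⊢
      exact hz.imp_left (And.imp_left (hZ z))
    · rw [T_swap]
      exact Or.inl ⟨hw, hwx⟩
    · rw [T_swap]
      rintro (⟨h, -⟩ | rfl)
      · exact hw' h
      · exact hy hw
    · rw [T_swap] at hz hz'
      push Not at hz'
      rcases hz with ⟨h, h'⟩ | h
      · exact hu z h fun h3 => h' (hz'.1 h3)
      · exact (hz'.2 h).elim

/-- `λAxz. Az ∨ z = x`: adjoin `x` to `A`. -/
def insC : Tm Δ ((σ ⇒ t) ⇒ σ ⇒ σ ⇒ t) := lam (lam (lam (or (app v2 v0) (eq v0 v1))))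

/-- The property `A` with `x` adjoined. -/
noncomputable def D.ins (A : M.D (σ ⇒ t)) (x : M.D σ) : M.D (σ ⇒ t) := den insC Env.nil ⬝ A ⬝ x

@[simp] theorem den_insC (r : M.Env Δ) (A : M.D (σ ⇒ t)) (x : M.D σ) :
    den insC r ⬝ A ⬝ x = A.ins x := (rfl)

@[simp] theorem ins_ap (A : M.D (σ ⇒ t)) (x z : M.D σ) : A.ins x ⬝ z = A ⬝ z ⊔ z.eqv x := by
  rw [D.ins, insC]
  simp

/-- `λnA. ∀B. (B ⊆ A → ¬nB)`: no subproperty of `A` has `n` instances. -/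
def bdC : Tm Δ (numTy σ ⇒ (σ ⇒ t) ⇒ t) := lam (lam (all (imp (sub v0 v1) (neg (app v2 v0)))))

/-- The proposition that no subproperty of `A` has `n` instances. -/
noncomputable def D.bd (n : M.D (numTy σ)) (A : M.D (σ ⇒ t)) : M.D t := den bdC Env.nil ⬝ n ⬝ A

@[simp] theorem den_bdC (r : M.Env Δ) (n : M.D (numTy σ)) (A : M.D (σ ⇒ t)) :
    den bdC r ⬝ n ⬝ A = n.bd A := (rfl)

theorem T_bd (n : M.D (numTy σ)) (A : M.D (σ ⇒ t)) :
    (n.bd A).T ↔ ∀ B : M.D (σ ⇒ t), (∀ x, (B ⬝ x).T → (A ⬝ x).T) → ¬ (n ⬝ B).T := by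
  rw [D.bd, bdC]
  simp

/-- Remove an element from a subproperty of `A.ins x` with `n + 1` instances: what is left, with `x`
replaced by the removed element if need be, is a subproperty of `A` with `n` instances. -/
theorem T_bd_succ_ins {n : M.D (numTy σ)} (hn : n.nat.T) {A : M.D (σ ⇒ t)} (x : M.D σ)
    (h : (n.bd A).T) : (n.succ.bd (A.ins x)).T := by
  rw [T_bd] at h ⊢
  intro B hB hnB
  obtain ⟨Y, hY, hnY, y, ⟨hy, hy'⟩, -⟩ := (T_succ n B).1 hnB
  simp only [ins_ap, T_sup, T_eqv] at hB
  by_cases hx : (Y ⬝ x).T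
  · refine h (Y.swap x y) (fun z hz => ?_) (T_num_swap hn hx hy' hnY)
    rcases (T_swap _ _ _ _).1 hz with ⟨h1, h2⟩ | rfl
    · exact (hB z (hY z h1)).resolve_right h2
    · exact (hB z hy).resolve_right fun h => hy' (h ▸ hx)
  · exact h Y (fun z hz => (hB z (hY z hz)).resolve_right fun h => hx (h ▸ hz)) hnY

theorem bd_le_bd_succ_ins {n : M.D (numTy σ)} (hn : n.nat.T) (A : M.D (σ ⇒ t)) (x : M.D σ) :
    n.bd A ≤ n.succ.bd (A.ins x) := by
  have := den_le_den (A := and (app natC v2) (app (app bdC v2) v1))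
    (B := app (app bdC (add v2 oneC)) (app (app insC v1) v0))
    (fun M r h => by
      simp only [den_and, den_app, den_natC, den_bdC, den_insC, den_add_oneC, T_inf] at h ⊢
      exact T_bd_succ_ins h.1 _ h.2) (((Env.nil.cons n).cons A).cons x)
  simpa [nat_eq_top hn] using this

/-- `λA. ∃n. (ℕn ∧ (∀B. (B ⊆ A → ¬nB)) = ⊤)`: some natural number is necessarily not reached by the
subproperties of `A`. -/
def boundedC : Tm Δ ((σ ⇒ t) ⇒ t) :=
  lam (ex (and (app natC v0) (eq (app (app bdC v0) v1) LF.top)))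

/-- The proposition that `A` is bounded, in the sense of `boundedC`. -/
noncomputable def D.bounded (A : M.D (σ ⇒ t)) : M.D t := den boundedC Env.nil ⬝ A

@[simp] theorem den_boundedC (r : M.Env Δ) (A : M.D (σ ⇒ t)) :
    den boundedC r ⬝ A = A.bounded := (rfl)

theorem T_bounded (A : M.D (σ ⇒ t)) : A.bounded.T ↔ ∃ n : M.D (numTy σ), n.nat.T ∧ n.bd A = ⊤ := by
  rw [D.bounded, boundedC]
  simp

theorem T_bounded_ins {A : M.D (σ ⇒ t)} (h : A.bounded.T) (x : M.D σ) : (A.ins x).bounded.T := by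
  rw [T_bounded] at h ⊢
  obtain ⟨n, hn, h⟩ := h
  exact ⟨n.succ, T_nat_succ hn, top_le_iff.1 (h ▸ bd_le_bd_succ_ins hn A x)⟩

/-- Necessarily, the empty property has no subproperty with one instance. -/
theorem T_bounded_empty : (den (lam LF.bot) (Env.nil : M.Env []) : M.D (σ ⇒ t)).bounded.T := by
  rw [T_bounded]
  refine ⟨_, T_nat_succ T_nat_zero, ?_⟩
  have := den_eq_top (A := app (app bdC (add zeroC oneC)) (lam (σ := σ) LF.bot)) (fun M r => by
    simp only [den_app, den_bdC, den_add_oneC, den_zeroC, T_bd, T_succ, den_lam, den_bot]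
    rintro B hB ⟨Y, -, -, y, ⟨hy, -⟩, -⟩
    exact not_T_bot (hB y hy)) (Env.nil : M.Env [])
  simpa using this

/-! ### There are infinitely many atoms -/

/-- `λBpqz. Bz ∨ (q ≤ z ∧ z ≤ p ∨ q)`: adjoin to `B` an interval of propositions. -/
def intervalC : Tm Δ ((t ⇒ t) ⇒ t ⇒ t ⇒ t ⇒ t) :=
  lam (lam (lam (lam (or (app v3 v0) (and (le v1 v0) (le v0 (or v2 v1)))))))

/-- The property `B` with the interval from `q` to `p ⊔ q` adjoined. -/
noncomputable def D.interval (B : M.D (t ⇒ t)) (p q : M.D t) : M.D (t ⇒ t) :=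
  den intervalC Env.nil ⬝ B ⬝ p ⬝ q

@[simp] theorem den_intervalC (r : M.Env Δ) (B : M.D (t ⇒ t)) (p q : M.D t) :
    den intervalC r ⬝ B ⬝ p ⬝ q = B.interval p q := (rfl)

theorem interval_ap (B : M.D (t ⇒ t)) (p q z : M.D t) :
    B.interval p q ⬝ z = B ⬝ z ⊔ ((q ⊓ z).eqv q ⊓ (z ⊓ (p ⊔ q)).eqv z) := by
  rw [D.interval, intervalC]
  simp

theorem interval_bot (B : M.D (t ⇒ t)) (q : M.D t) : B.interval ⊥ q = B.ins q := by
  refine D.ext fun z => ?_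
  rw [interval_ap, ins_ap]
  congr 1
  refine ((D.Rigid.eqv _ _).inf (D.Rigid.eqv _ _)).congr (D.Rigid.eqv _ _) ?_
  simp only [T_inf, T_eqv, bot_sup_eq]
  exact ⟨fun h => le_antisymm h.2 h.1, fun h => by simp [h]⟩

/-- A proposition between `q` and the join of `q`, `p` and an atom `a` either lies between `q` and
the join of `q` and `p`, or is above `a`. -/
theorem interval_sup_atom (B : M.D (t ⇒ t)) (p q : M.D t) {a : M.D t} (ha : IsAtom a) :
    B.interval (p ⊔ a) q = (B.interval p q).interval p (a ⊔ q) := by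
  refine D.ext fun z => ?_
  rw [interval_ap, interval_ap, interval_ap, sup_assoc (B ⬝ z)]
  congr 1
  refine ((D.Rigid.eqv _ _).inf (D.Rigid.eqv _ _)).congr
    (((D.Rigid.eqv _ _).inf (D.Rigid.eqv _ _)).sup
      ((D.Rigid.eqv _ _).inf (D.Rigid.eqv _ _))) ?_
  simp only [T_inf, T_sup, T_le, ← sup_assoc]
  constructor
  · rintro ⟨h1, h2⟩
    by_cases haz : a ≤ z
    · exact Or.inr ⟨sup_le haz h1, h2⟩
    · refine Or.inl ⟨h1, ?_⟩
      have hd : Disjoint z a := by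
        rw [disjoint_iff]
        refine (ha.le_iff.1 inf_le_right).resolve_right fun h => haz (inf_eq_right.1 h)
      exact hd.left_le_of_le_sup_right (h2.trans (sup_right_comm p a q).le)
  · rintro (⟨h1, h2⟩ | ⟨h1, h2⟩)
    · exact ⟨h1, h2.trans (sup_le_sup_right le_sup_left _)⟩
    · exact ⟨le_sup_right.trans h1, h2⟩

/-- `λp. ∀X. (X⊥ → ∀q. ∀a. (Xq → Atom a → X(q ∨ a)) → Xp)`: `p` is a join of finitely many atoms. -/
def finJoinC : Tm Δ (t ⇒ t) :=
  lam (all (σ := t ⇒ t) (imp (app v0 LF.bot) (imp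
    (all (all (imp (app v2 v1) (imp (app atomC v0) (app v2 (or v1 v0)))))) (app v0 v1))))

/-- The proposition that `p` is a join of finitely many atoms. -/
noncomputable def D.finJoin (p : M.D t) : M.D t := den finJoinC Env.nil ⬝ p

@[simp] theorem den_finJoinC (r : M.Env Δ) (p : M.D t) : den finJoinC r ⬝ p = p.finJoin := (rfl)

theorem T_finJoin (p : M.D t) : p.finJoin.T ↔ ∀ X : M.D (t ⇒ t), (X ⬝ ⊥).T →
    (∀ q a, (X ⬝ q).T → IsAtom a → (X ⬝ (q ⊔ a)).T) → (X ⬝ p).T := by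
  rw [D.finJoin, finJoinC]
  simp [T_atomC]

theorem T_finJoin_bot : (⊥ : M.D t).finJoin.T := (T_finJoin _).2 fun _ h _ => h

theorem T_finJoin_sup {p a : M.D t} (h : p.finJoin.T) (ha : IsAtom a) : (p ⊔ a).finJoin.T :=
  (T_finJoin _).2 fun X h0 hs => hs _ _ ((T_finJoin p).1 h X h0 hs) ha

/-- If `p` is a join of finitely many atoms then adjoining an interval of length `p` preserves
boundedness. -/
theorem T_bounded_interval {p : M.D t} (h : p.finJoin.T) (q : M.D t) {B : M.D (t ⇒ t)}
    (hB : B.bounded.T) : (B.interval p q).bounded.T := by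
  have := (T_finJoin p).1 h (den (lam (all (all (σ := t ⇒ t) (imp (app boundedC v0)
    (app boundedC (app (app (app intervalC v0) v2) v1)))))) Env.nil)
  simp only [den_lam, den_all, den_imp, den_app, den_v0, den_v1, den_v2, Env.cons_zero,
    Env.cons_succ, den_boundedC, den_intervalC, T_all, T_himp] at this
  refine this (fun q B hB => ?_) (fun p a ih ha q B hB => ?_) q B hB
  · rw [interval_bot]
    exact T_bounded_ins hB q
  · rw [interval_sup_atom B p q ha]
    exact ih _ _ (ih _ _ hB)

/-- Otherwise the property of lying between `⊥` and `⊤` would be bounded, so that for some natural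
number `n` it would be impossible that there are `n` propositions. -/
theorem not_T_finJoin_top : ¬ (⊤ : M.D t).finJoin.T := by
  intro h
  obtain ⟨n, hn, hb⟩ := (T_bounded _).1 (T_bounded_interval h ⊥ T_bounded_empty)
  refine ex_ne_bot hn ?_
  have := den_congr (A := app (app bdC v0) (app (app (app intervalC (lam LF.bot)) LF.top) LF.bot))
    (B := neg (app exC v0)) (fun M r => by
      simp [T_bd, interval_ap]) (Env.nil.cons n)
  have e : den (lam LF.bot) (Env.nil.cons n) = den (lam LF.bot) (Env.nil : M.Env []) :=
    D.ext (σ := t) fun z => by simp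
  simp only [den_app, den_bdC, den_intervalC, den_v0, Env.cons_zero, den_top, den_bot, den_neg,
    den_exC, e, hb] at this
  exact compl_eq_top.1 this.symm

/-! ### A sequence of disjoint propositions -/

/-- `λSnp. ∀R. (R0⊥ → ∀m. ∀q. (Rmq → R(m + 1)(Sq)) → Rnp)`: `p` is an `n`-th iterate of `S` at `⊥`.
As a type may have too few members for its natural numbers to be distinct, `p` need not be
determined by `n`. -/
def iterC : Tm Δ ((t ⇒ t) ⇒ numTy σ ⇒ t ⇒ t) :=
  lam (lam (lam (all (σ := numTy σ ⇒ t ⇒ t) (imp (app (app v0 zeroC) LF.bot) (imp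
    (all (all (imp (app (app v2 v1) v0) (app (app v2 (add v1 oneC)) (app v5 v0)))))
    (app (app v0 v2) v1))))))

/-- The proposition that `p` is an `n`-th iterate of `S` at `⊥`. -/
noncomputable def D.iter (S : M.D (t ⇒ t)) (n : M.D (numTy σ)) (p : M.D t) : M.D t :=
  den iterC Env.nil ⬝ S ⬝ n ⬝ p

@[simp] theorem den_iterC (r : M.Env Δ) (S : M.D (t ⇒ t)) (n : M.D (numTy σ)) (p : M.D t) :
    den iterC r ⬝ S ⬝ n ⬝ p = S.iter n p := (rfl)

theorem T_iter (S : M.D (t ⇒ t)) (n : M.D (numTy σ)) (p : M.D t) :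
    (S.iter n p).T ↔ ∀ R : M.D (numTy σ ⇒ t ⇒ t), (R ⬝ zero ⬝ ⊥).T →
      (∀ m q, (R ⬝ m ⬝ q).T → (R ⬝ m.succ ⬝ (S ⬝ q)).T) → (R ⬝ n ⬝ p).T := by
  rw [D.iter, iterC]
  simp

theorem T_iter_zero (S : M.D (t ⇒ t)) : (S.iter (zero (σ := σ)) ⊥).T :=
  (T_iter _ _ _).2 fun _ h _ => h

theorem T_iter_succ {S : M.D (t ⇒ t)} {n : M.D (numTy σ)} {p : M.D t} (h : (S.iter n p).T) :
    (S.iter n.succ (S ⬝ p)).T :=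
  (T_iter _ _ _).2 fun R h0 hs => hs _ _ ((T_iter _ _ _).1 h R h0 hs)

theorem exists_iter (S : M.D (t ⇒ t)) {n : M.D (numTy σ)} (hn : n.nat.T) :
    ∃ p, (S.iter n p).T := by
  have := (T_nat n).1 hn (den (lam (ex (app (app (app iterC v2) v1) v0))) (Env.nil.cons S))
  simp only [den_lam, den_ex, den_app, den_v0, den_v1, den_v2, Env.cons_zero, Env.cons_succ,
    den_iterC, T_ex] at this
  exact this ⟨_, T_iter_zero S⟩ fun m ⟨p, hp⟩ => ⟨_, T_iter_succ hp⟩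

section Iterates

variable {S : M.D (t ⇒ t)} (hS : ∀ p, p ≤ S ⬝ p)
  (hne : ∀ (n : M.D (numTy σ)) (p : M.D t), (S.iter n p).T → S ⬝ p ≠ p)

include hS

/-- Nothing in the sequence lies strictly between `⊥` and `S ⊥`. -/
theorem iter_zero_trichotomy {m : M.D (numTy σ)} {q : M.D t} (h : (S.iter m q).T) :
    (zero = m ∧ ⊥ = q) ∨ S ⬝ ⊥ ≤ q := by
  have := (T_iter S m q).1 h (den (lam (lam (or (and (eq zeroC v1) (eq LF.bot v0))
    (le (app v2 LF.bot) v0)))) (Env.nil.cons S))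
  simp only [den_lam, den_or, den_and, den_app, den_eq, den_le, den_v0, den_v1, den_v2,
    Env.cons_zero, Env.cons_succ, den_zeroC, den_bot, T_sup, T_inf, T_eqv, ← le_iff_inf_eq]
    at this
  refine this (by simp) ?_
  rintro m q (⟨-, rfl⟩ | h)
  · exact Or.inr le_rfl
  · exact Or.inr (h.trans (hS q))

include hne

/-- The inner induction for `iter_trichotomy`: if `p` is comparable with all iterates, then no
iterate lies strictly between `S p` and `S (S p)`. -/
theorem iter_succ_trichotomy {n : M.D (numTy σ)} {p : M.D t} (hp : (S.iter n p).T)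
    (ih : ∀ m q, (S.iter m q).T → (n = m ∧ p = q) ∨ S ⬝ p ≤ q ∨ S ⬝ q ≤ p)
    {m : M.D (numTy σ)} {q : M.D t} (h : (S.iter m q).T) (hpq : S ⬝ p ≤ q) :
    (n.succ = m ∧ S ⬝ p = q) ∨ S ⬝ (S ⬝ p) ≤ q := by
  have := (T_iter S m q).1 h (den (lam (lam (and (app (app (app iterC v4) v1) v0)
    (imp (le (app v4 v2) v0) (or (and (eq (add v3 oneC) v1) (eq (app v4 v2) v0))
      (le (app v4 (app v4 v2)) v0)))))) (((Env.nil.cons S).cons n).cons p))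
  simp only [den_lam, den_or, den_and, den_imp, den_app, den_eq, den_le, den_v0, den_v1, den_v2,
    den_v3, den_v4, Env.cons_zero, Env.cons_succ, den_add_oneC, den_iterC, T_sup, T_inf,
    T_himp, T_eqv, ← le_iff_inf_eq] at this
  refine (this ⟨T_iter_zero S, fun h0 => ?_⟩ ?_).2 hpq
  · exact (hne n p hp (le_antisymm ((h0.trans bot_le)) (hS p))).elim
  · rintro m q ⟨hq, ihq⟩
    refine ⟨T_iter_succ hq, fun h1 => ?_⟩
    rcases ih m q hq with ⟨rfl, rfl⟩ | h2 | h2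
    · exact Or.inl ⟨rfl, rfl⟩
    · rcases ihq h2 with ⟨rfl, rfl⟩ | h3
      · exact Or.inr le_rfl
      · exact Or.inr (h3.trans (hS q))
    · exact (hne n p hp (le_antisymm (h1.trans h2) (hS p))).elim

/-- Of two iterates, either both have the same index and the same value, or one lies above the
successor of the other. -/
theorem iter_trichotomy {n m : M.D (numTy σ)} {p q : M.D t} (hp : (S.iter n p).T)
    (hq : (S.iter m q).T) : (n = m ∧ p = q) ∨ S ⬝ p ≤ q ∨ S ⬝ q ≤ p := by
  have := (T_iter S n p).1 hp (den (lam (lam (and (app (app (app iterC v2) v1) v0)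
    (all (σ := numTy σ) (all (imp (app (app (app iterC v4) v1) v0) (or (and (eq v3 v1) (eq v2 v0))
      (or (le (app v4 v2) v0) (le (app v4 v0) v2))))))))) (Env.nil.cons S))
  simp only [den_lam, den_or, den_and, den_imp, den_app, den_eq, den_le, den_all, den_v0, den_v1,
    den_v2, den_v3, den_v4, Env.cons_zero, Env.cons_succ, den_iterC, T_sup, T_inf, T_all,
    T_himp, T_eqv, ← le_iff_inf_eq] at this
  refine (this ⟨T_iter_zero S, fun m q hq => ?_⟩ ?_).2 m q hq
  · exact (iter_zero_trichotomy hS hq).imp_right Or.inl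
  · rintro n p ⟨hp, ih⟩
    refine ⟨T_iter_succ hp, fun m q hq => ?_⟩
    rcases ih m q hq with ⟨rfl, rfl⟩ | h | h
    · exact Or.inr (Or.inr le_rfl)
    · exact (iter_succ_trichotomy hS hne hp ih hq h).imp_right Or.inl
    · exact Or.inr (Or.inr (h.trans (hS p)))

/-- The increments of the iterates are nonzero and pairwise disjoint. -/
theorem exists_disjoint_of_iter : ∃ g : M.D (numTy σ ⇒ t),
    (∀ n, n.nat.T → g ⬝ n ≠ ⊥) ∧ ∀ n m, n.nat.T → m.nat.T → g ⬝ n ⊓ g ⬝ m ≠ ⊥ → n = m := by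
  obtain ⟨h, hh⟩ := exists_choice (den (lam (lam (imp (app natC v1)
    (app (app (app iterC v2) v1) v0)))) (Env.nil.cons S)) (fun n : M.D (numTy σ) => by
      by_cases hn : n.nat.T
      · obtain ⟨p, hp⟩ := exists_iter S hn
        exact ⟨p, by simp [hp]⟩
      · exact ⟨⊥, by simp [hn]⟩)
  simp only [den_lam, den_imp, den_app, den_v0, den_v1, den_v2, Env.cons_zero, Env.cons_succ,
    den_natC, den_iterC, T_himp] at hh
  have hd : ∀ {p q : M.D t}, S ⬝ p ≤ q → (S ⬝ p ⊓ pᶜ) ⊓ (S ⬝ q ⊓ qᶜ) = ⊥ := fun hpq => by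
    rw [← disjoint_iff]
    exact (disjoint_compl_right.mono_left hpq).mono inf_le_left inf_le_right
  refine ⟨den (lam (and (app v2 (app v1 v0)) (neg (app v1 v0)))) ((Env.nil.cons S).cons h),
    fun n hn h0 => ?_, fun n m hn hm h0 => ?_⟩
  · simp only [den_lam, den_and, den_neg, den_app, den_v0, den_v1, den_v2, Env.cons_zero,
      Env.cons_succ] at h0
    refine hne n _ (hh n hn) (le_antisymm ?_ (hS _))
    rwa [← disjoint_iff, disjoint_compl_right_iff] at h0
  · simp only [den_lam, den_and, den_neg, den_app, den_v0, den_v1, den_v2, Env.cons_zero,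
      Env.cons_succ] at h0
    rcases iter_trichotomy hS hne (hh n hn) (hh m hm) with h1 | h1 | h1
    · exact h1.1
    · exact (h0 (hd h1)).elim
    · exact (h0 (by rw [inf_comm]; exact hd h1)).elim

end Iterates

/-- There is a family of nonzero propositions, indexed by the natural numbers, of which any two
distinct ones are disjoint. Starting from `⊥`, a chosen atom outside the current proposition is
added at each step; the atoms never run out, as `⊤` is not a join of finitely many of them. -/
theorem exists_disjoint (M : Henkin) (σ : Ty) : ∃ g : M.D (numTy σ ⇒ t),
    (∀ n, n.nat.T → g ⬝ n ≠ ⊥) ∧ ∀ n m, n.nat.T → m.nat.T → g ⬝ n ⊓ g ⬝ m ≠ ⊥ → n = m := by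
  obtain ⟨c, hc⟩ := exists_choice (den (lam (lam (or (eq v1 LF.top)
    (and (app atomC v0) (le v0 (neg v1)))))) Env.nil) (fun p : M.D t => by
      by_cases hp : p = ⊤
      · exact ⟨⊥, by simp [hp]⟩
      · obtain ⟨a, ha, hap⟩ := (eq_bot_or_exists_atom_le pᶜ).resolve_left
          fun h => hp (compl_eq_bot.1 h)
        exact ⟨a, by simp [T_atomC, ha, hap]⟩)
  simp only [den_lam, den_or, den_and, den_app, den_eq, den_le, den_neg, den_top, den_v0, den_v1,
    Env.cons_zero, Env.cons_succ, T_sup, T_inf, T_eqv, ← le_iff_inf_eq, T_atomC] at hc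
  have hS : ∀ p : M.D t, den (lam (or v0 (app v1 v0))) (Env.nil.cons c) ⬝ p = p ⊔ c ⬝ p := by
    simp
  -- an iterate never has a complement that is a finite join of atoms
  have hinf : ∀ (n : M.D (numTy σ)) (p : M.D t),
      ((den (lam (or v0 (app v1 v0))) (Env.nil.cons c)).iter n p).T → ¬ (pᶜ).finJoin.T := by
    intro n p hp
    have := (T_iter _ _ _).1 hp (den (lam (lam (neg (app finJoinC (neg v0))))) Env.nil)
    simp only [den_lam, den_neg, den_app, den_v0, Env.cons_zero, den_finJoinC, T_compl,
      hS] at this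
    refine this (by simpa using not_T_finJoin_top) fun _ q hq h => hq ?_
    rcases hc q with rfl | ⟨ha, hle⟩
    · simpa using T_finJoin_bot
    · have e : (q ⊔ c ⬝ q)ᶜ ⊔ c ⬝ q = qᶜ := by
        rw [compl_sup, sup_inf_right, compl_sup_eq_top, inf_top_eq, sup_eq_left]
        exact hle
      exact e ▸ T_finJoin_sup h ha
  refine exists_disjoint_of_iter (S := den (lam (or v0 (app v1 v0))) (Env.nil.cons c))
    (fun p => by rw [hS]; exact le_sup_left) fun n p hp h => ?_
  rw [hS] at h
  rcases hc p with rfl | ⟨ha, hle⟩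
  · exact hinf _ _ hp (by simpa using T_finJoin_bot)
  · refine ha.1 (le_compl_self.1 (hle.trans (compl_le_compl (sup_eq_left.1 h))))

/-! ### At least continuum many propositions -/

theorem T_natClassC (r : M.Env Δ) (X : M.D (numTy σ ⇒ t)) :
    (den natClassC r ⬝ X).T ↔ (∀ n, (X ⬝ n).Rigid) ∧ ∀ n, (X ⬝ n).T → n.nat.T := by
  rw [natClassC, classC]
  simp [D.Rigid]

theorem T_atLeastContinuum (σ : Ty) (r : M.Env []) : (den (atLeastContinuum σ) r).T := by
  obtain ⟨g, hg, hg'⟩ := exists_disjoint M σ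
  simp only [atLeastContinuum, den_ex, den_all, den_imp, den_and, den_app, den_eq, den_lam, den_v0,
    den_v1, den_v2, Env.cons_zero, Env.cons_succ, T_ex, T_all, T_himp, T_inf, T_eqv, T_natClassC]
  -- send a class of numbers to the join of the corresponding disjoint propositions
  refine ⟨den (lam (ex (and (app v1 v0) (app v2 v0)))) (Env.nil.cons g), ?_⟩
  simp only [den_lam, den_ex]
  have key : ∀ X Y : M.D (numTy σ ⇒ t), (∀ n, (X ⬝ n).Rigid) → (∀ n, (X ⬝ n).T → n.nat.T) →
      (∀ n, (Y ⬝ n).Rigid) → (∀ n, (Y ⬝ n).T → n.nat.T) →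
      (den (lam (and (app v1 v0) (app v2 v0))) ((Env.nil.cons g).cons X)).ex =
        (den (lam (and (app v1 v0) (app v2 v0))) ((Env.nil.cons g).cons Y)).ex →
      ∀ n, (X ⬝ n).T → (Y ⬝ n).T := by
    intro X Y hX hXN hY hYN h n hn
    have h1 : g ⬝ n ≤ (den (lam (and (app v1 v0) (app v2 v0))) ((Env.nil.cons g).cons Y)).ex := by
      rw [← h]
      refine le_trans ?_ (le_ex _ n)
      simp [(hX n).eq_top hn]
    obtain ⟨m, hm⟩ := exists_inf_ne_bot (by rw [inf_eq_left.2 h1]; exact hg n (hXN n hn))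
    simp only [den_lam, den_and, den_app, den_v0, den_v1, den_v2, Env.cons_zero,
      Env.cons_succ] at hm
    have hYm : (Y ⬝ m).T := (hY m).T_of_ne_bot fun h => by simp [h] at hm
    rw [(hY m).eq_top hYm, top_inf_eq] at hm
    exact hg' n m (hXN n hn) (hYN m hYm) hm ▸ hYm
  rintro X Y ⟨⟨hX, hXN⟩, ⟨hY, hYN⟩, h⟩
  exact D.ext fun n => (hX n).congr (hY n)
    ⟨key X Y hX hXN hY hYN h n, key Y X hY hYN hX hXN h.symm n⟩

end Henkin

theorem closed_atLeastContinuum (σ : Ty) : (atLeastContinuum σ).Closed := by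
  intro ρ n h
  revert h
  simp [atLeastContinuum, natClassC, classC, natC, zeroC, oneC, add, addC, sdiffC, and, andC, or,
    orC, neg, negC, imp, impC, all, allC, ex, exC, eq, eqC, LF.top, LF.bot, sub, v0, v1, v2,
    v3, Occurs]

theorem isTheorem_atLeastContinuum (σ : Ty) : IsTheorem (atLeastContinuum σ) :=
  ⟨closed_atLeastContinuum σ, Henkin.provable_of_forall_T fun _ =>
    Henkin.T_atLeastContinuum σ _⟩

end LF

theorem mainTheorem6 :
    LF.IsTheorem LF.completeAtomicBooleanAlgebra ∧
      ∀ σ : LF.Ty, LF.IsTheorem (LF.atLeastContinuum σ) :=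
  ⟨LF.isTheorem_completeAtomicBooleanAlgebra, LF.isTheorem_atLeastContinuum⟩
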